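/- Let $X$ be a finite (simple, non-oriented) graph with $n\ge 1$ vertices, $n\neq 4$, which is cyclic in the following sense: its vertices can be labelled by the elements of $\mathbb{Z}_n$ in such a way that all translations $k\mapsto g+k$ $(g\in\mathbb{Z}_n)$ are automorphisms of $X$. Fix such a labelling, and let $Q(z)=\sum_{k=1}^{n-1}e(k)z^k$ be the associated polynomial, where $e(k)=1$ if the vertices $0$ and $k$ are connected by an edge, and $e(k)=0$ otherwise. Let $d$ be the $0$--$1$ incidency (adjacency) matrix of $X$. Let $H(X)$ be the universal $C^*$-algebra generated by elements $v_{ij}$ ($i,j$ vertices of $X$), with the relations saying that $v=(v_{ij})$ is a magic biunitary (all $v_{ij}$ are self-adjoint projections, and each row and each column of $v$ consists of pairwise orthogonal projections with sum $1$) and that $vd=dv$. It is a Hopf $C^*$-algebra, with $\Delta(v_{ij})=\sum_k v_{ik}\otimes v_{kj}$ (here $\otimes$ is taken to be the maximal $C^*$-tensor product), $\varepsilon(v_{ij})=\delta_{ij}$ and $S(v_{ij})=v_{ji}$. Let $D_n$ be the symmetry group of the $n$-gon, viewed as the group of all permutations of $\mathbb{Z}_n$ of the form $k\mapsto c+k$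 or $k\mapsto c-k$; it has order $2n$ for $n\ge 3$, and orders $1$ and $2$ for $n=1$ and $n=2$. Let $w\in\mathbb{C}$ be a primitive $n$-th root of unity. If the numbers $$Q(1),\,Q(w),\,Q(w^2),\ldots,Q(w^{[n/2]})$$ are distinct, then $H(X)$ is the algebra of functions on $D_n$: there is an isomorphism of Hopf $C^*$-algebras $H(X)\to\mathbb{C}(D_n)$ which maps each $v_{ij}$ to the characteristic function of $\{\sigma\in D_n\mid\sigma(j)=i\}$. Moreover, let $c_k$ be the dimension of the space of fixed points of the $k$-th tensor power of $v$, i.e. of the space of functions $f$ on $k$-tuples of vertices such that $\sum_{i}f(i_1,\ldots,i_k)\,v_{j_1i_1}\cdots v_{j_ki_k}=f(j_1,\ldots,j_k)\,1$ for all $j_1,\ldots,j_k$. The Poincaré series $f(z)=\sum_{k\ge 0}c_kz^k$ has convergence radius $1/n$, and for $|z|<1/n$ $$f(z)=1+\frac{z}{2}\left(\frac{1}{1-\varepsilon z}+\frac{1}{1-nz}\right),$$ where $\varepsilon=1$ if $n$ is odd and $\varepsilon=2$ if $n$ is even. -/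

import Mathlib

open scoped TensorProduct

/-- A C⋆-seminorm on a complex ⋆-algebra: a submultiplicative seminorm satisfying the
C⋆-identity `p (a⋆ a) = p a ^ 2`. -/
structure CStarSeminorm (A : Type*) [Ring A] [StarRing A] [Algebra ℂ A] extends
    Seminorm ℂ A where
  mul_le' : ∀ a b : A, toFun (a * b) ≤ toFun a * toFun b
  star_mul_self' : ∀ a : A, toFun (star a * a) = toFun a ^ 2

namespace CStarSeminorm

section Basic

variable {A : Type*} [Ring A] [StarRing A] [Algebra ℂ A]

noncomputable instance : CoeFun (CStarSeminorm A) (fun _ => A → ℝ) := ⟨fun p => p.toSeminorm⟩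

theorem nonneg (p : CStarSeminorm A) (a : A) : 0 ≤ p a := apply_nonneg p.toSeminorm a

theorem mul_le (p : CStarSeminorm A) (a b : A) : p (a * b) ≤ p a * p b := p.mul_le' a b

theorem star_mul_self (p : CStarSeminorm A) (a : A) : p (star a * a) = p a ^ 2 :=
  p.star_mul_self' a

theorem le_star (p : CStarSeminorm A) (a : A) : p a ≤ p (star a) := by
  by_contra! h
  have h1 := p.mul_le (star a) a
  rw [p.star_mul_self] at h1
  nlinarith [p.nonneg a, p.nonneg (star a)]

theorem star_eq (p : CStarSeminorm A) (a : A) : p (star a) = p a :=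
  le_antisymm (by simpa using p.le_star (star a)) (p.le_star a)

/-- The pointwise supremum of a pointwise bounded set of C⋆-seminorms. -/
noncomputable def sup (P : Set (CStarSeminorm A))
    (hP : ∀ a, BddAbove (Set.range fun p : P => p.1 a)) : CStarSeminorm A where
  toFun a := ⨆ p : P, p.1 a
  map_zero' := by simp
  add_le' a b := Real.iSup_le (fun p => (map_add_le_add p.1.toSeminorm a b).trans
      (add_le_add (le_ciSup (hP a) p) (le_ciSup (hP b) p)))
    (add_nonneg (Real.iSup_nonneg fun p => p.1.nonneg a) (Real.iSup_nonneg fun p => p.1.nonneg b))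
  neg' a := by simp
  smul' c a := by
    simp only [map_smul_eq_mul]
    exact (Real.mul_iSup_of_nonneg (norm_nonneg c) _).symm
  mul_le' a b := Real.iSup_le (fun p => (p.1.mul_le a b).trans
      (mul_le_mul (le_ciSup (hP a) p) (le_ciSup (hP b) p) (p.1.nonneg b)
        (Real.iSup_nonneg fun p => p.1.nonneg a)))
    (mul_nonneg (Real.iSup_nonneg fun p => p.1.nonneg a) (Real.iSup_nonneg fun p => p.1.nonneg b))
  star_mul_self' a := by
    simp only [star_mul_self]
    apply le_antisymm
    · refine Real.iSup_le (fun p => ?_) (sq_nonneg _)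
      exact pow_le_pow_left₀ (p.1.nonneg a) (le_ciSup (hP a) p) 2
    · have h0 : 0 ≤ ⨆ p : P, p.1 a ^ 2 := Real.iSup_nonneg fun p => sq_nonneg _
      have hb : BddAbove (Set.range fun p : P => p.1 a ^ 2) := by
        obtain ⟨C, hC⟩ := hP a
        refine ⟨C ^ 2, ?_⟩
        rintro _ ⟨p, rfl⟩
        exact pow_le_pow_left₀ (p.1.nonneg a) (hC ⟨p, rfl⟩) 2
      rw [← Real.le_sqrt (Real.iSup_nonneg fun p => p.1.nonneg a) h0]
      exact Real.iSup_le (fun p => Real.le_sqrt_of_sq_le (le_ciSup hb p)) (Real.sqrt_nonneg _)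

theorem sup_apply (P : Set (CStarSeminorm A))
    (hP : ∀ a, BddAbove (Set.range fun p : P => p.1 a)) (a : A) :
    sup P hP a = ⨆ p : P, p.1 a := rfl

theorem le_sup {P : Set (CStarSeminorm A)}
    (hP : ∀ a, BddAbove (Set.range fun p : P => p.1 a)) {p : CStarSeminorm A} (hp : p ∈ P)
    (a : A) : p a ≤ sup P hP a :=
  le_ciSup (hP a) (⟨p, hp⟩ : P)

/-- The C⋆-seminorm `a ↦ ‖φ a‖` defined by a morphism to a C⋆-algebra. -/
noncomputable def ofHom {B : Type*} [CStarAlgebra B] (φ : A →⋆ₐ[ℂ] B) : CStarSeminorm A where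
  toFun a := ‖φ a‖
  map_zero' := by simp
  add_le' a b := by simpa using norm_add_le (φ a) (φ b)
  neg' a := by simp
  smul' c a := by simp [norm_smul]
  mul_le' a b := by simpa using norm_mul_le (φ a) (φ b)
  star_mul_self' a := by simp [map_star, CStarRing.norm_star_mul_self, sq]

theorem ofHom_apply {B : Type*} [CStarAlgebra B] (φ : A →⋆ₐ[ℂ] B) (a : A) :
    ofHom φ a = ‖φ a‖ := rfl

end Basic

section Completion

variable {A : Type*} [Ring A] [StarRing A] [Algebra ℂ A]

/-- The algebra `A`, to be endowed with the seminorm `p`. -/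
def Pre (_p : CStarSeminorm A) : Type _ := A

variable (p : CStarSeminorm A)

instance : Ring p.Pre := inferInstanceAs (Ring A)
instance : StarRing p.Pre := inferInstanceAs (StarRing A)
instance : Algebra ℂ p.Pre := inferInstanceAs (Algebra ℂ A)
instance [StarModule ℂ A] : StarModule ℂ p.Pre := inferInstanceAs (StarModule ℂ A)

/-- The underlying ring seminorm. -/
noncomputable def toRingSeminorm : RingSeminorm p.Pre where
  toFun a := p.toSeminorm (a : A)
  map_zero' := map_zero p.toSeminorm
  add_le' a b := map_add_le_add p.toSeminorm (a : A) (b : A)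
  neg' a := map_neg_eq_map p.toSeminorm (a : A)
  mul_le' a b := p.mul_le (a : A) (b : A)

noncomputable instance : SeminormedRing p.Pre := p.toRingSeminorm.toSeminormedRing

/-- The identity map, from `A` to `A` endowed with the seminorm `p`. -/
def toPre (a : A) : p.Pre := a

theorem norm_toPre (a : A) : ‖p.toPre a‖ = p a := rfl

instance : NormedSpace ℂ p.Pre where
  norm_smul_le c a := (map_smul_eq_mul p.toSeminorm c (show A from a)).le

instance : NormedStarGroup p.Pre where
  norm_star_le a := (p.star_eq (show A from a)).le

/-- The C⋆-algebra obtained from `A` and a C⋆-seminorm `p` by separation and completion. -/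
def Completion : Type _ := UniformSpace.Completion p.Pre

noncomputable instance : NormedRing p.Completion :=
  inferInstanceAs (NormedRing (UniformSpace.Completion p.Pre))

noncomputable instance : NormedAlgebra ℂ p.Completion where
  __ := (inferInstanceAs (Algebra ℂ (UniformSpace.Completion p.Pre)) : Algebra ℂ p.Completion)
  norm_smul_le c x := norm_smul_le (β := UniformSpace.Completion p.Pre) c x

instance : CompleteSpace p.Completion :=
  inferInstanceAs (CompleteSpace (UniformSpace.Completion p.Pre))

/-- The canonical map from `A` to its completion. -/
noncomputable def mkFun (a : A) : p.Completion :=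
  ((p.toPre a : p.Pre) : UniformSpace.Completion p.Pre)

theorem mkFun_mul (a b : A) : p.mkFun (a * b) = p.mkFun a * p.mkFun b :=
  UniformSpace.Completion.coe_mul (p.toPre a) (p.toPre b)

theorem mkFun_add (a b : A) : p.mkFun (a + b) = p.mkFun a + p.mkFun b :=
  UniformSpace.Completion.coe_add (p.toPre a) (p.toPre b)

theorem mkFun_smul (c : ℂ) (a : A) : p.mkFun (c • a) = c • p.mkFun a :=
  UniformSpace.Completion.coe_smul c (p.toPre a)

theorem norm_mkFun (a : A) : ‖p.mkFun a‖ = p a :=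
  UniformSpace.Completion.norm_coe (p.toPre a)

theorem denseRange_mkFun : DenseRange p.mkFun :=
  UniformSpace.Completion.denseRange_coe (α := p.Pre)

theorem uniformContinuous_star : UniformContinuous (star : p.Pre → p.Pre) :=
  uniformContinuous_of_continuousAt_zero (starAddEquiv : p.Pre ≃+ p.Pre).toAddMonoidHom
    continuous_star.continuousAt

noncomputable instance : Star p.Completion where
  star := UniformSpace.Completion.map (star : p.Pre → p.Pre)

theorem continuous_star' : Continuous (star : p.Completion → p.Completion) :=
  UniformSpace.Completion.continuous_map

theorem star_mkFun (a : A) : star (p.mkFun a) = p.mkFun (star a) :=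
  UniformSpace.Completion.map_coe p.uniformContinuous_star (p.toPre a)

noncomputable instance : StarRing p.Completion where
  star_involutive x := by
    refine p.denseRange_mkFun.induction_on x
      (isClosed_eq (p.continuous_star'.comp p.continuous_star') continuous_id) fun a => ?_
    rw [star_mkFun, star_mkFun, star_star]
  star_mul x y := by
    refine p.denseRange_mkFun.induction_on₂ (p := fun x y => star (x * y) = star y * star x)
      (isClosed_eq (p.continuous_star'.comp continuous_mul)
        ((p.continuous_star'.comp continuous_snd).mul (p.continuous_star'.comp continuous_fst)))
      (fun a b => ?_) x y
    rw [← mkFun_mul, star_mkFun, star_mkFun, star_mkFun, star_mul, mkFun_mul]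
  star_add x y := by
    refine p.denseRange_mkFun.induction_on₂ (p := fun x y => star (x + y) = star x + star y)
      (isClosed_eq (p.continuous_star'.comp continuous_add)
        ((p.continuous_star'.comp continuous_fst).add (p.continuous_star'.comp continuous_snd)))
      (fun a b => ?_) x y
    rw [← mkFun_add, star_mkFun, star_mkFun, star_mkFun, star_add, mkFun_add]

instance : CStarRing p.Completion where
  norm_mul_self_le x := by
    refine p.denseRange_mkFun.induction_on x
      (isClosed_le (continuous_norm.mul continuous_norm)
        (continuous_norm.comp (p.continuous_star'.mul continuous_id))) fun a => ?_
    rw [star_mkFun, ← mkFun_mul, norm_mkFun, norm_mkFun, star_mul_self, sq]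

instance [StarModule ℂ A] : StarModule ℂ p.Completion where
  star_smul c x := by
    refine p.denseRange_mkFun.induction_on x
      (isClosed_eq (p.continuous_star'.comp (continuous_const_smul c))
        ((continuous_const_smul (star c)).comp p.continuous_star')) fun a => ?_
    rw [← mkFun_smul, star_mkFun, star_mkFun, star_smul, mkFun_smul]

noncomputable instance [StarModule ℂ A] : CStarAlgebra p.Completion where

/-- The canonical morphism from `A` to its completion. -/
noncomputable def toCompletion : A →⋆ₐ[ℂ] p.Completion where
  toFun := p.mkFun
  map_one' := rfl
  map_mul' := p.mkFun_mul
  map_zero' := rfl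
  map_add' := p.mkFun_add
  commutes' _ := rfl
  map_star' a := (p.star_mkFun a).symm

theorem norm_toCompletion (a : A) : ‖p.toCompletion a‖ = p a := p.norm_mkFun a

theorem denseRange_toCompletion : DenseRange p.toCompletion := p.denseRange_mkFun

theorem toCompletion_eq_zero_iff (a : A) : p.toCompletion a = 0 ↔ p a = 0 := by
  rw [← norm_eq_zero, norm_toCompletion]

/-- A morphism from `A` to a C⋆-algebra which is bounded by `p` extends to the completion. -/
noncomputable def lift {B : Type*} [CStarAlgebra B] (φ : A →⋆ₐ[ℂ] B) (h : ∀ a, ‖φ a‖ ≤ p a) :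
    p.Completion →⋆ₐ[ℂ] B :=
  let φ' : p.Pre →+* B := (φ : A →+* B)
  have hφ : Continuous φ' :=
    AddMonoidHomClass.continuous_of_bound φ' 1 fun a => by
      simpa using! h (show A from a)
  { UniformSpace.Completion.extensionHom φ' hφ with
    commutes' := fun c => by
      have := UniformSpace.Completion.extensionHom_coe φ' hφ (p.toPre (algebraMap ℂ A c))
      exact this.trans (φ.commutes c)
    map_star' := fun x => by
      have hc : Continuous (UniformSpace.Completion.extensionHom φ' hφ) :=
        UniformSpace.Completion.continuous_extension
      refine p.denseRange_mkFun.induction_on x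
        (isClosed_eq (hc.comp p.continuous_star') (continuous_star.comp hc)) fun a => ?_
      have h1 := UniformSpace.Completion.extensionHom_coe φ' hφ (p.toPre a)
      have h2 := UniformSpace.Completion.extensionHom_coe φ' hφ (p.toPre (star a))
      rw [star_mkFun]
      refine h2.trans ((map_star φ a).trans ?_)
      exact congrArg star h1.symm }

@[simp]
theorem lift_toCompletion {B : Type*} [CStarAlgebra B] (φ : A →⋆ₐ[ℂ] B) (h : ∀ a, ‖φ a‖ ≤ p a) (a : A) :
    p.lift φ h (p.toCompletion a) = φ a := by
  let φ' : p.Pre →+* B := (φ : A →+* B)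
  have hφ : Continuous φ' :=
    AddMonoidHomClass.continuous_of_bound φ' 1 fun a => by
      simpa using! h (show A from a)
  exact UniformSpace.Completion.extensionHom_coe φ' hφ (p.toPre a)

end Completion

end CStarSeminorm

/-! ### The free ⋆-algebra on self-adjoint generators -/

instance FreeAlgebra.instStarModuleReal (I : Type*) : StarModule ℝ (FreeAlgebra ℝ I) where
  star_smul r a := by
    rw [Algebra.smul_def, star_mul, FreeAlgebra.star_algebraMap, Algebra.smul_def,
      star_trivial r, Algebra.commutes]

/-- The free complex ⋆-algebra (noncommutative polynomials) on self-adjoint generators indexed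
by `I`: the complexification of the free real algebra, with `(c ⊗ w)⋆ = conj c ⊗ reverse w`. -/
abbrev FreeStarAlgebra (I : Type*) : Type _ := ℂ ⊗[ℝ] FreeAlgebra ℝ I

namespace FreeStarAlgebra

variable {I : Type*}

instance : StarModule ℂ (FreeStarAlgebra I) where
  star_smul c a := by
    induction a using TensorProduct.induction_on with
    | zero => simp
    | tmul d f => simp [TensorProduct.smul_tmul']
    | add a b ha hb => simp only [smul_add, star_add, ha, hb]

/-- The self-adjoint generators. -/
noncomputable def gen (i : I) : FreeStarAlgebra I := 1 ⊗ₜ[ℝ] FreeAlgebra.ι ℝ i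

theorem star_gen (i : I) : star (gen i) = gen i := by
  simp [gen]

/-- A family of self-adjoint elements of a C⋆-algebra defines a morphism. -/
noncomputable def lift {B : Type*} [CStarAlgebra B] (u : I → B) (hu : ∀ i, star (u i) = u i) :
    FreeStarAlgebra I →⋆ₐ[ℂ] B where
  __ := AlgHom.liftEquiv ℝ ℂ (FreeAlgebra ℝ I) B (FreeAlgebra.lift ℝ u)
  map_star' a := by
    have key : ∀ f : FreeAlgebra ℝ I,
        FreeAlgebra.lift ℝ u (star f) = star (FreeAlgebra.lift ℝ u f) := by
      intro f
      induction f using FreeAlgebra.induction with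
      | grade0 r =>
        rw [FreeAlgebra.star_algebraMap, AlgHom.commutes, Algebra.algebraMap_eq_smul_one,
          star_smul, star_trivial, star_one]
      | grade1 i => simp [hu]
      | mul a b ha hb => simp [ha, hb]
      | add a b ha hb => simp [ha, hb]
    induction a using TensorProduct.induction_on with
    | zero => simp
    | tmul c f => simp [key]
    | add a b ha hb => simpa using congrArg₂ (· + ·) ha hb

@[simp]
theorem lift_gen {B : Type*} [CStarAlgebra B] (u : I → B) (hu : ∀ i, star (u i) = u i) (i : I) :
    lift u hu (gen i) = u i := by
  change AlgHom.liftEquiv ℝ ℂ (FreeAlgebra ℝ I) B (FreeAlgebra.lift ℝ u) (gen i) = u i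
  simp [gen]

theorem bddAbove_of_gen (P : Set (CStarSeminorm (FreeStarAlgebra I)))
    (hP : ∀ p ∈ P, ∀ i, p (gen i) ≤ 1) (a : FreeStarAlgebra I) :
    BddAbove (Set.range fun p : P => p.1 a) := by
  suffices h : ∃ C : ℝ, ∀ p ∈ P, p a ≤ C by
    obtain ⟨C, hC⟩ := h
    exact ⟨C, by rintro _ ⟨p, rfl⟩; exact hC p.1 p.2⟩
  have hadd : ∀ a b : FreeStarAlgebra I, (∃ C : ℝ, ∀ p ∈ P, p a ≤ C) →
      (∃ C : ℝ, ∀ p ∈ P, p b ≤ C) → ∃ C : ℝ, ∀ p ∈ P, p (a + b) ≤ C := by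
    rintro a b ⟨C, hC⟩ ⟨D, hD⟩
    exact ⟨C + D, fun p hp => (map_add_le_add p.toSeminorm a b).trans
      (add_le_add (hC p hp) (hD p hp))⟩
  have hsmul : ∀ (c : ℂ) (a : FreeStarAlgebra I), (∃ C : ℝ, ∀ p ∈ P, p a ≤ C) →
      ∃ C : ℝ, ∀ p ∈ P, p (c • a) ≤ C := by
    rintro c a ⟨C, hC⟩
    refine ⟨‖c‖ * C, fun p hp => ?_⟩
    rw [map_smul_eq_mul]
    exact mul_le_mul_of_nonneg_left (hC p hp) (norm_nonneg c)
  have hmul : ∀ a b : FreeStarAlgebra I, (∃ C : ℝ, ∀ p ∈ P, p a ≤ C) →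
      (∃ C : ℝ, ∀ p ∈ P, p b ≤ C) → ∃ C : ℝ, ∀ p ∈ P, p (a * b) ≤ C := by
    rintro a b ⟨C, hC⟩ ⟨D, hD⟩
    refine ⟨C * D, fun p hp => (p.mul_le a b).trans ?_⟩
    exact mul_le_mul (hC p hp) (hD p hp) (p.nonneg b) ((p.nonneg a).trans (hC p hp))
  have hone : ∃ C : ℝ, ∀ p ∈ P, p (1 : FreeStarAlgebra I) ≤ C := by
    refine ⟨1, fun p _ => ?_⟩
    have := p.star_mul_self 1
    rw [star_one, one_mul] at this
    nlinarith [p.nonneg 1]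
  have hf : ∀ f : FreeAlgebra ℝ I, ∃ C : ℝ, ∀ p ∈ P, p ((1 : ℂ) ⊗ₜ[ℝ] f) ≤ C := by
    intro f
    induction f using FreeAlgebra.induction with
    | grade0 r =>
      have : (1 : ℂ) ⊗ₜ[ℝ] algebraMap ℝ (FreeAlgebra ℝ I) r = (r : ℂ) • (1 : FreeStarAlgebra I) := by
        rw [Algebra.TensorProduct.one_def, TensorProduct.smul_tmul', Algebra.algebraMap_eq_smul_one,
          TensorProduct.tmul_smul, TensorProduct.smul_tmul']
        simp
      rw [this]
      exact hsmul _ _ hone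
    | grade1 i => exact ⟨1, fun p hp => hP p hp i⟩
    | mul a b ha hb => simpa using hmul _ _ ha hb
    | add a b ha hb => rw [TensorProduct.tmul_add]; exact hadd _ _ ha hb
  induction a using TensorProduct.induction_on with
  | zero => exact ⟨0, fun p _ => (map_zero p.toSeminorm).le⟩
  | tmul c f =>
    have : c ⊗ₜ[ℝ] f = c • ((1 : ℂ) ⊗ₜ[ℝ] f) := by simp [TensorProduct.smul_tmul']
    rw [this]
    exact hsmul _ _ (hf f)
  | add a b ha hb => exact hadd _ _ ha hb

end FreeStarAlgebra

/-! ### The maximal tensor product of C⋆-algebras -/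

namespace MaxTensor

section

variable {A B A' B' : Type*} [CStarAlgebra A] [CStarAlgebra B] [CStarAlgebra A'] [CStarAlgebra B']

theorem bddAbove (t : A ⊗[ℂ] B) :
    BddAbove (Set.range fun p : (Set.univ : Set (CStarSeminorm (A ⊗[ℂ] B))) => p.1 t) := by
  suffices h : ∃ C : ℝ, ∀ p : CStarSeminorm (A ⊗[ℂ] B), p t ≤ C by
    obtain ⟨C, hC⟩ := h
    exact ⟨C, by rintro _ ⟨p, rfl⟩; exact hC p.1⟩
  induction t using TensorProduct.induction_on with
  | zero => exact ⟨0, fun p => (map_zero p.toSeminorm).le⟩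
  | tmul a b =>
    refine ⟨‖a‖ * ‖b‖, fun p => ?_⟩
    let l : A →⋆ₐ[ℂ] A ⊗[ℂ] B :=
      { (Algebra.TensorProduct.includeLeft : A →ₐ[ℂ] A ⊗[ℂ] B) with
        map_star' := fun a => by simp }
    let r : B →⋆ₐ[ℂ] A ⊗[ℂ] B :=
      { (Algebra.TensorProduct.includeRight : B →ₐ[ℂ] A ⊗[ℂ] B) with
        map_star' := fun a => by simp }
    have hl : p (a ⊗ₜ[ℂ] 1) ≤ ‖a‖ := by
      have := NonUnitalStarAlgHom.norm_apply_le (p.toCompletion.comp l) a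
      rwa [StarAlgHom.comp_apply, p.norm_toCompletion] at this
    have hr : p (1 ⊗ₜ[ℂ] b) ≤ ‖b‖ := by
      have := NonUnitalStarAlgHom.norm_apply_le (p.toCompletion.comp r) b
      rwa [StarAlgHom.comp_apply, p.norm_toCompletion] at this
    have h : a ⊗ₜ[ℂ] b = (a ⊗ₜ[ℂ] (1 : B)) * ((1 : A) ⊗ₜ[ℂ] b) := by simp
    rw [h]
    exact (p.mul_le _ _).trans (mul_le_mul hl hr (p.nonneg _) (norm_nonneg a))
  | add s t hs ht =>
    obtain ⟨C, hC⟩ := hs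
    obtain ⟨D, hD⟩ := ht
    exact ⟨C + D, fun p => (map_add_le_add p.toSeminorm s t).trans (add_le_add (hC p) (hD p))⟩

variable (A B) in
/-- The largest C⋆-seminorm on the algebraic tensor product. -/
noncomputable def seminorm : CStarSeminorm (A ⊗[ℂ] B) :=
  CStarSeminorm.sup Set.univ bddAbove

end

end MaxTensor

/-- The maximal tensor product of two C⋆-algebras: the completion of the algebraic tensor product
with respect to its largest C⋆-seminorm. -/
def MaxTensor (A B : Type*) [CStarAlgebra A] [CStarAlgebra B] : Type _ :=
  (MaxTensor.seminorm A B).Completion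

namespace MaxTensor

variable {A B A' B' : Type*} [CStarAlgebra A] [CStarAlgebra B] [CStarAlgebra A'] [CStarAlgebra B']

noncomputable instance : CStarAlgebra (MaxTensor A B) :=
  inferInstanceAs (CStarAlgebra (seminorm A B).Completion)

variable (A B) in
/-- The canonical morphism from the algebraic to the maximal tensor product. -/
noncomputable def ofAlgebraic : A ⊗[ℂ] B →⋆ₐ[ℂ] MaxTensor A B := (seminorm A B).toCompletion

/-- The elementary tensor `a ⊗ b`. -/
noncomputable def tmul (a : A) (b : B) : MaxTensor A B := ofAlgebraic A B (a ⊗ₜ[ℂ] b)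

theorem tmul_mul_tmul (a a' : A) (b b' : B) :
    tmul a b * tmul a' b' = tmul (a * a') (b * b') := by
  simp only [tmul, ← map_mul, Algebra.TensorProduct.tmul_mul_tmul]

theorem star_tmul (a : A) (b : B) : star (tmul a b) = tmul (star a) (star b) := by
  simp only [tmul, ← map_star, TensorProduct.star_tmul]

theorem one_tmul_one : tmul (1 : A) (1 : B) = 1 := by
  simp only [tmul, ← Algebra.TensorProduct.one_def, map_one]

theorem tmul_zero (a : A) : tmul a (0 : B) = 0 := by simp [tmul]

theorem zero_tmul (b : B) : tmul (0 : A) b = 0 := by simp [tmul]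

theorem sum_tmul {ι : Type*} (s : Finset ι) (f : ι → A) (b : B) :
    tmul (∑ i ∈ s, f i) b = ∑ i ∈ s, tmul (f i) b := by
  simp only [tmul, TensorProduct.sum_tmul, map_sum]

theorem tmul_sum {ι : Type*} (s : Finset ι) (a : A) (f : ι → B) :
    tmul a (∑ i ∈ s, f i) = ∑ i ∈ s, tmul a (f i) := by
  simp only [tmul, TensorProduct.tmul_sum, map_sum]

theorem smul_tmul (c : ℂ) (a : A) (b : B) : tmul (c • a) b = c • tmul a b := by
  simp only [tmul, ← map_smul, TensorProduct.smul_tmul']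

theorem tmul_smul (c : ℂ) (a : A) (b : B) : tmul a (c • b) = c • tmul a b := by
  simp only [tmul, ← map_smul, TensorProduct.tmul_smul]

/-- The morphism `φ ⊗ ψ` between algebraic tensor products. -/
noncomputable def algebraicMap (φ : A →⋆ₐ[ℂ] A') (ψ : B →⋆ₐ[ℂ] B') :
    A ⊗[ℂ] B →⋆ₐ[ℂ] A' ⊗[ℂ] B' where
  __ := Algebra.TensorProduct.map φ.toAlgHom ψ.toAlgHom
  map_star' t := by
    induction t using TensorProduct.induction_on with
    | zero => simp
    | tmul a b => simp [map_star]
    | add s t hs ht => simpa using congrArg₂ (· + ·) hs ht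

/-- The morphism `φ ⊗ ψ` between maximal tensor products. -/
noncomputable def map (φ : A →⋆ₐ[ℂ] A') (ψ : B →⋆ₐ[ℂ] B') :
    MaxTensor A B →⋆ₐ[ℂ] MaxTensor A' B' :=
  (seminorm A B).lift ((ofAlgebraic A' B').comp (algebraicMap φ ψ)) fun t =>
    CStarSeminorm.le_sup bddAbove
      (Set.mem_univ (CStarSeminorm.ofHom ((ofAlgebraic A' B').comp (algebraicMap φ ψ)))) t

theorem map_tmul (φ : A →⋆ₐ[ℂ] A') (ψ : B →⋆ₐ[ℂ] B') (a : A) (b : B) :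
    map φ ψ (tmul a b) = tmul (φ a) (ψ b) :=
  ((seminorm A B).lift_toCompletion _ _ (a ⊗ₜ[ℂ] b)).trans <|
    congrArg (ofAlgebraic A' B') (Algebra.TensorProduct.map_tmul φ.toAlgHom ψ.toAlgHom a b)

end MaxTensor

/-! ### Magic biunitary matrices and the universal algebra `H(X,d)` -/

/-- A square matrix over a ⋆-algebra is a magic biunitary if its rows and columns are partitions
of unity with pairwise orthogonal self-adjoint projections. -/
structure IsMagicBiunitary {V : Type*} [Fintype V] {B : Type*} [Ring B] [StarRing B]
    (u : Matrix V V B) : Prop where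
  isStarProjection : ∀ i j, IsStarProjection (u i j)
  row_orthogonal : ∀ i j k, j ≠ k → u i j * u i k = 0
  col_orthogonal : ∀ i j k, i ≠ k → u i j * u k j = 0
  row_sum : ∀ i, ∑ j, u i j = 1
  col_sum : ∀ j, ∑ i, u i j = 1

/-- The matrix `u` with entries in a complex algebra commutes with the scalar matrix `d`. -/
def CommutesWith {V : Type*} [Fintype V] {B : Type*} [Ring B] [Algebra ℂ B]
    (u : Matrix V V B) (d : Matrix V V ℂ) : Prop :=
  u * d.map (algebraMap ℂ B) = d.map (algebraMap ℂ B) * u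

theorem commutesWith_iff {V : Type*} [Fintype V] {B : Type*} [Ring B] [Algebra ℂ B]
    (u : Matrix V V B) (d : Matrix V V ℂ) :
    CommutesWith u d ↔ ∀ i j, ∑ k, d k j • u i k = ∑ k, d i k • u k j := by
  simp only [CommutesWith, ← Matrix.ext_iff, Matrix.mul_apply, Matrix.map_apply,
    Algebra.smul_def]
  simp only [Algebra.commutes]

namespace QuantumSymmetry

section

variable {V : Type*} [Fintype V]

/-- The generator `x i j` of the free ⋆-algebra. -/
noncomputable def x (i j : V) : FreeStarAlgebra (V × V) := FreeStarAlgebra.gen (i, j)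

/-- The elements of the free ⋆-algebra whose vanishing means that the matrix of (self-adjoint)
generators is a magic biunitary which commutes with `d`. -/
inductive Rel (d : Matrix V V ℂ) : FreeStarAlgebra (V × V) → Prop
  | idem (i j : V) : Rel d (x i j * x i j - x i j)
  | row_orthogonal (i j k : V) (h : j ≠ k) : Rel d (x i j * x i k)
  | col_orthogonal (i j k : V) (h : i ≠ k) : Rel d (x i j * x k j)
  | row_sum (i : V) : Rel d (∑ j, x i j - 1)
  | col_sum (j : V) : Rel d (∑ i, x i j - 1)
  | comm (i j : V) : Rel d (∑ k, d k j • x i k - ∑ k, d i k • x k j)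

/-- The C⋆-seminorms which vanish on the relations. -/
def seminorms (d : Matrix V V ℂ) : Set (CStarSeminorm (FreeStarAlgebra (V × V))) :=
  {p | ∀ r, Rel d r → p r = 0}

theorem bddAbove (d : Matrix V V ℂ) (a : FreeStarAlgebra (V × V)) :
    BddAbove (Set.range fun p : seminorms d => p.1 a) := by
  refine FreeStarAlgebra.bddAbove_of_gen _ (fun p hp ij => ?_) a
  have h1 : p (x ij.1 ij.2 * x ij.1 ij.2 - x ij.1 ij.2) = 0 := hp _ (.idem _ _)
  have h2 := p.star_mul_self (x ij.1 ij.2)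
  rw [x, FreeStarAlgebra.star_gen] at h2
  rw [x] at h1
  have h3 := map_sub_le_add p.toSeminorm
    (FreeStarAlgebra.gen (ij.1, ij.2) * FreeStarAlgebra.gen (ij.1, ij.2))
    (FreeStarAlgebra.gen (ij.1, ij.2) * FreeStarAlgebra.gen (ij.1, ij.2) -
      FreeStarAlgebra.gen (ij.1, ij.2))
  rw [sub_sub_cancel, h1] at h3
  have h4 := map_add_le_add p.toSeminorm
    (FreeStarAlgebra.gen (ij.1, ij.2) * FreeStarAlgebra.gen (ij.1, ij.2) -
      FreeStarAlgebra.gen (ij.1, ij.2)) (FreeStarAlgebra.gen (ij.1, ij.2))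
  rw [sub_add_cancel, h1] at h4
  change p (FreeStarAlgebra.gen (ij.1, ij.2)) ≤ 1
  nlinarith [p.nonneg (FreeStarAlgebra.gen (ij.1, ij.2))]

/-- The largest C⋆-seminorm which vanishes on the relations. -/
noncomputable def seminorm (d : Matrix V V ℂ) : CStarSeminorm (FreeStarAlgebra (V × V)) :=
  CStarSeminorm.sup (seminorms d) (bddAbove d)

theorem seminorm_rel (d : Matrix V V ℂ) {r : FreeStarAlgebra (V × V)} (hr : Rel d r) :
    seminorm d r = 0 :=
  le_antisymm (Real.iSup_le (fun p => (p.2 r hr).le) le_rfl) ((seminorm d).nonneg r)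

end

end QuantumSymmetry

/-- The universal C⋆-algebra `H(X,d)` generated by the entries of a magic biunitary matrix, indexed
by `V`, which commutes with `d`. -/
def QuantumSymmetry {V : Type*} [Fintype V] (d : Matrix V V ℂ) : Type _ :=
  (QuantumSymmetry.seminorm d).Completion

namespace QuantumSymmetry

variable {V : Type*} [Fintype V] (d : Matrix V V ℂ)

noncomputable instance : CStarAlgebra (QuantumSymmetry d) :=
  inferInstanceAs (CStarAlgebra (seminorm d).Completion)

/-- The canonical morphism from the free ⋆-algebra. -/
noncomputable def ofFree : FreeStarAlgebra (V × V) →⋆ₐ[ℂ] QuantumSymmetry d :=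
  (seminorm d).toCompletion

theorem denseRange_ofFree : DenseRange (ofFree d) := (seminorm d).denseRange_toCompletion

/-- The universal coaction: the matrix of generators of `H(X,d)`. -/
noncomputable def coaction : Matrix V V (QuantumSymmetry d) :=
  Matrix.of fun i j => ofFree d (x i j)

theorem coaction_apply (i j : V) : coaction d i j = ofFree d (x i j) := rfl

theorem ofFree_rel {r : FreeStarAlgebra (V × V)} (hr : Rel d r) : ofFree d r = 0 :=
  ((seminorm d).toCompletion_eq_zero_iff r).2 (seminorm_rel d hr)

theorem isMagicBiunitary_coaction : IsMagicBiunitary (coaction d) where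
  isStarProjection i j := by
    refine ⟨?_, ?_⟩
    · have := ofFree_rel d (.idem i j)
      rwa [map_sub, map_mul, sub_eq_zero] at this
    · rw [IsSelfAdjoint, coaction_apply, ← map_star, x, FreeStarAlgebra.star_gen]
  row_orthogonal i j k h := by
    have := ofFree_rel d (.row_orthogonal i j k h)
    rwa [map_mul] at this
  col_orthogonal i j k h := by
    have := ofFree_rel d (.col_orthogonal i j k h)
    rwa [map_mul] at this
  row_sum i := by
    have := ofFree_rel d (.row_sum i)
    rwa [map_sub, map_sum, map_one, sub_eq_zero] at this
  col_sum j := by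
    have := ofFree_rel d (.col_sum j)
    rwa [map_sub, map_sum, map_one, sub_eq_zero] at this

theorem commutesWith_coaction : CommutesWith (coaction d) d := by
  rw [commutesWith_iff]
  intro i j
  have := ofFree_rel d (.comm i j)
  simpa only [map_sub, map_sum, map_smul, sub_eq_zero, ← coaction_apply] using this

section Lift

variable {d} {B : Type*} [CStarAlgebra B] {u : Matrix V V B}

/-- Auxiliary morphism for the universal property. -/
noncomputable def freeLift (hu : IsMagicBiunitary u) : FreeStarAlgebra (V × V) →⋆ₐ[ℂ] B :=
  FreeStarAlgebra.lift (fun ij : V × V => u ij.1 ij.2)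
    fun ij => (hu.isStarProjection ij.1 ij.2).isSelfAdjoint

theorem freeLift_x (hu : IsMagicBiunitary u) (i j : V) : freeLift hu (x i j) = u i j :=
  FreeStarAlgebra.lift_gen _ _ _

theorem freeLift_rel (hu : IsMagicBiunitary u) (hd : CommutesWith u d)
    {r : FreeStarAlgebra (V × V)} (hr : Rel d r) : freeLift hu r = 0 := by
  rw [commutesWith_iff] at hd
  cases hr with
  | idem i j =>
    simpa only [map_sub, map_mul, freeLift_x, sub_eq_zero] using
      (hu.isStarProjection i j).isIdempotentElem.eq
  | row_orthogonal i j k h => simpa only [map_mul, freeLift_x] using hu.row_orthogonal i j k h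
  | col_orthogonal i j k h => simpa only [map_mul, freeLift_x] using hu.col_orthogonal i j k h
  | row_sum i =>
    simpa only [map_sub, map_sum, map_one, freeLift_x, sub_eq_zero] using hu.row_sum i
  | col_sum j =>
    simpa only [map_sub, map_sum, map_one, freeLift_x, sub_eq_zero] using hu.col_sum j
  | comm i j =>
    simpa only [map_sub, map_sum, map_smul, freeLift_x, sub_eq_zero] using hd i j

/-- The universal property of `H(X,d)`: a magic biunitary with entries in a C⋆-algebra, commuting
with `d`, defines a morphism from `H(X,d)`. -/
noncomputable def lift (hu : IsMagicBiunitary u) (hd : CommutesWith u d) :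
    QuantumSymmetry d →⋆ₐ[ℂ] B :=
  (seminorm d).lift (freeLift hu) fun a =>
    CStarSeminorm.le_sup (bddAbove d) (p := CStarSeminorm.ofHom (freeLift hu))
      (fun r hr => by rw [CStarSeminorm.ofHom_apply, freeLift_rel hu hd hr, norm_zero]) a

theorem lift_coaction (hu : IsMagicBiunitary u) (hd : CommutesWith u d) (i j : V) :
    lift hu hd (coaction d i j) = u i j :=
  ((seminorm d).lift_toCompletion _ _ (x i j)).trans (freeLift_x hu i j)

end Lift

/-! ### The Hopf structure of `H(X,d)` -/

/-- The matrix `w i j = ∑ k, v i k ⊗ v k j`. -/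
noncomputable def comulMatrix :
    Matrix V V (MaxTensor (QuantumSymmetry d) (QuantumSymmetry d)) :=
  Matrix.of fun i j => ∑ k, MaxTensor.tmul (coaction d i k) (coaction d k j)

theorem isMagicBiunitary_comulMatrix : IsMagicBiunitary (comulMatrix d) := by
  classical
  have hv := isMagicBiunitary_coaction d
  have hmul : ∀ i j i' j', comulMatrix d i j * comulMatrix d i' j' = ∑ k, ∑ l,
      MaxTensor.tmul (coaction d i k * coaction d i' l) (coaction d k j * coaction d l j') := by
    intro i j i' j'
    simp only [comulMatrix, Matrix.of_apply, Finset.sum_mul_sum, MaxTensor.tmul_mul_tmul]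
  refine ⟨fun i j => ⟨?_, ?_⟩, fun i j k h => ?_, fun i j k h => ?_, fun i => ?_, fun j => ?_⟩
  · rw [IsIdempotentElem, hmul]
    simp only [comulMatrix, Matrix.of_apply]
    refine Finset.sum_congr rfl fun k _ => ?_
    rw [Finset.sum_eq_single k]
    · rw [(hv.isStarProjection i k).isIdempotentElem.eq,
        (hv.isStarProjection k j).isIdempotentElem.eq]
    · intro l _ hl
      rw [hv.row_orthogonal i k l hl.symm, MaxTensor.zero_tmul]
    · simp
  · rw [IsSelfAdjoint]
    simp only [comulMatrix, Matrix.of_apply, star_sum, MaxTensor.star_tmul,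
      (hv.isStarProjection _ _).isSelfAdjoint.star_eq]
  · rw [hmul]
    refine Finset.sum_eq_zero fun l _ => Finset.sum_eq_zero fun m _ => ?_
    by_cases hlm : l = m
    · rw [hlm, hv.row_orthogonal m j k h, MaxTensor.tmul_zero]
    · rw [hv.row_orthogonal i l m hlm, MaxTensor.zero_tmul]
  · rw [hmul]
    refine Finset.sum_eq_zero fun l _ => Finset.sum_eq_zero fun m _ => ?_
    by_cases hlm : l = m
    · rw [hlm, hv.col_orthogonal i m k h, MaxTensor.zero_tmul]
    · rw [hv.col_orthogonal l j m hlm, MaxTensor.tmul_zero]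
  · simp only [comulMatrix, Matrix.of_apply]
    rw [Finset.sum_comm]
    simp only [← MaxTensor.tmul_sum, hv.row_sum]
    rw [← MaxTensor.sum_tmul, hv.row_sum, MaxTensor.one_tmul_one]
  · simp only [comulMatrix, Matrix.of_apply]
    rw [Finset.sum_comm]
    simp only [← MaxTensor.sum_tmul, hv.col_sum]
    rw [← MaxTensor.tmul_sum, hv.col_sum, MaxTensor.one_tmul_one]

theorem commutesWith_comulMatrix : CommutesWith (comulMatrix d) d := by
  have hd := (commutesWith_iff _ _).1 (commutesWith_coaction d)
  rw [commutesWith_iff]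
  intro i j
  simp only [comulMatrix, Matrix.of_apply, Finset.smul_sum]
  rw [Finset.sum_comm]
  simp only [← MaxTensor.tmul_smul, ← MaxTensor.tmul_sum, hd]
  simp only [MaxTensor.tmul_sum, MaxTensor.tmul_smul, ← MaxTensor.smul_tmul]
  rw [Finset.sum_comm]
  simp only [← MaxTensor.sum_tmul, hd]
  simp only [MaxTensor.sum_tmul]
  rw [Finset.sum_comm]

/-- The comultiplication `Δ (v i j) = ∑ k, v i k ⊗ v k j`. -/
noncomputable def comul :
    QuantumSymmetry d →⋆ₐ[ℂ] MaxTensor (QuantumSymmetry d) (QuantumSymmetry d) :=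
  lift (isMagicBiunitary_comulMatrix d) (commutesWith_comulMatrix d)

open Classical in
theorem isMagicBiunitary_one : IsMagicBiunitary (1 : Matrix V V ℂ) where
  isStarProjection i j := by
    by_cases h : i = j
    · subst h; simp [IsStarProjection.one]
    · simp [Matrix.one_apply_ne h, IsStarProjection.zero]
  row_orthogonal i j k h := by
    by_cases hij : i = j
    · subst hij; simp [Matrix.one_apply_ne h]
    · simp [Matrix.one_apply_ne hij]
  col_orthogonal i j k h := by
    by_cases hij : i = j
    · subst hij; simp [Matrix.one_apply_ne h.symm]
    · simp [Matrix.one_apply_ne hij]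
  row_sum i := by simp [Matrix.one_apply]
  col_sum j := by simp [Matrix.one_apply]

open Classical in
/-- The counit `ε (v i j) = δ_{ij}`. -/
noncomputable def counit : QuantumSymmetry d →⋆ₐ[ℂ] ℂ :=
  lift (u := (1 : Matrix V V ℂ)) isMagicBiunitary_one (by simp [CommutesWith])

/-- The transpose matrix, with entries in the opposite algebra. -/
noncomputable def antipodeMatrix : Matrix V V (QuantumSymmetry d)ᵐᵒᵖ :=
  Matrix.of fun i j => MulOpposite.op (coaction d j i)

theorem isMagicBiunitary_antipodeMatrix : IsMagicBiunitary (antipodeMatrix d) := by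
  have hv := isMagicBiunitary_coaction d
  refine ⟨fun i j => ⟨?_, ?_⟩, fun i j k h => ?_, fun i j k h => ?_, fun i => ?_, fun j => ?_⟩
  · exact congrArg MulOpposite.op (hv.isStarProjection j i).isIdempotentElem.eq
  · exact congrArg MulOpposite.op (hv.isStarProjection j i).isSelfAdjoint.star_eq
  · exact congrArg MulOpposite.op (hv.col_orthogonal k i j h.symm)
  · exact congrArg MulOpposite.op (hv.row_orthogonal j k i h.symm)
  · simp only [antipodeMatrix, Matrix.of_apply, ← Finset.op_sum, hv.col_sum,
      MulOpposite.op_one]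
  · simp only [antipodeMatrix, Matrix.of_apply, ← Finset.op_sum, hv.row_sum,
      MulOpposite.op_one]

theorem commutesWith_transpose : CommutesWith (coaction d).transpose d := by
  classical
  have hv := isMagicBiunitary_coaction d
  have h1 : coaction d * (coaction d).transpose = 1 := by
    ext i j
    rw [Matrix.mul_apply]
    by_cases h : i = j
    · subst h
      simp only [Matrix.transpose_apply, (hv.isStarProjection _ _).isIdempotentElem.eq,
        hv.row_sum, Matrix.one_apply_eq]
    · simp only [Matrix.transpose_apply, hv.col_orthogonal _ _ _ h, Finset.sum_const_zero,
        Matrix.one_apply_ne h]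
  have h2 : (coaction d).transpose * coaction d = 1 := by
    ext i j
    rw [Matrix.mul_apply]
    by_cases h : i = j
    · subst h
      simp only [Matrix.transpose_apply, (hv.isStarProjection _ _).isIdempotentElem.eq,
        hv.col_sum, Matrix.one_apply_eq]
    · simp only [Matrix.transpose_apply, hv.row_orthogonal _ _ _ h, Finset.sum_const_zero,
        Matrix.one_apply_ne h]
  have h3 := commutesWith_coaction d
  rw [CommutesWith] at h3 ⊢
  set D := d.map (algebraMap ℂ (QuantumSymmetry d))
  calc (coaction d).transpose * D
      = (coaction d).transpose * (D * (coaction d * (coaction d).transpose)) := by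
        rw [h1, mul_one]
    _ = (coaction d).transpose * (D * coaction d) * (coaction d).transpose := by
        simp only [mul_assoc]
    _ = ((coaction d).transpose * coaction d) * D * (coaction d).transpose := by
        rw [← h3]; simp only [mul_assoc]
    _ = D * (coaction d).transpose := by rw [h2, one_mul]

theorem commutesWith_antipodeMatrix : CommutesWith (antipodeMatrix d) d := by
  have h := (commutesWith_iff _ _).1 (commutesWith_transpose d)
  rw [commutesWith_iff]
  intro i j
  simpa only [antipodeMatrix, Matrix.of_apply, Matrix.transpose_apply, Finset.op_sum,
    MulOpposite.op_smul] using congrArg MulOpposite.op (h i j)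

/-- The antipode `S (v i j) = v j i`, with values in the opposite algebra. -/
noncomputable def antipode : QuantumSymmetry d →⋆ₐ[ℂ] (QuantumSymmetry d)ᵐᵒᵖ :=
  lift (isMagicBiunitary_antipodeMatrix d) (commutesWith_antipodeMatrix d)

end QuantumSymmetry

/-! ### The Hopf algebra of functions on a finite group -/

namespace FunctionAlgebra

variable {G : Type*} [Group G] [Fintype G]

open Classical in
/-- The comultiplication of `C(G)`: the function `(g, h) ↦ f (g h)`, as an element of
`C(G) ⊗ C(G)`. -/
noncomputable def comul (f : G → ℂ) : MaxTensor (G → ℂ) (G → ℂ) :=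
  ∑ g, ∑ h, f (g * h) • MaxTensor.tmul (Pi.single g 1 : G → ℂ) (Pi.single h 1 : G → ℂ)

/-- The counit of `C(G)`. -/
def counit (f : G → ℂ) : ℂ := f 1

/-- The antipode of `C(G)`. -/
def antipode (f : G → ℂ) : G → ℂ := fun g => f g⁻¹

end FunctionAlgebra

/-! ### Poincaré series -/

section Poincare

variable {V : Type*} [Fintype V] {B : Type*} [Ring B] [Algebra ℂ B]

/-- The space of fixed points of the `k`-th tensor power of the coaction with coefficients `v`.
Here `C(X)^{⊗ k}` is the space of functions on `X ^ k`, and `v^{⊗ k}` is given by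
`δ_i ↦ ∑ j, δ_j ⊗ v (j 1) (i 1) * ⋯ * v (j k) (i k)`. -/
def fixedPoints (v : Matrix V V B) (k : ℕ) : Submodule ℂ ((Fin k → V) → ℂ) where
  carrier := {f | ∀ j : Fin k → V,
    ∑ i : Fin k → V, f i • (List.ofFn fun l => v (j l) (i l)).prod = f j • (1 : B)}
  add_mem' {f g} hf hg j := by
    simp only [Pi.add_apply, add_smul, Finset.sum_add_distrib, hf j, hg j]
  zero_mem' j := by simp
  smul_mem' c f hf j := by
    simp only [Pi.smul_apply, smul_eq_mul, mul_smul, ← Finset.smul_sum, hf j]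

/-- The coefficients of the Poincaré series of a coaction. -/
noncomputable def poincareCoeff (v : Matrix V V B) (k : ℕ) : ℕ :=
  Module.finrank ℂ (fixedPoints v k)

/-- The Poincaré series of a coaction, as a formal power series. -/
noncomputable def poincareSeries (v : Matrix V V B) : FormalMultilinearSeries ℂ ℂ ℂ :=
  FormalMultilinearSeries.ofScalars ℂ fun k => (poincareCoeff v k : ℂ)

end Poincare

/-! ### Graphs -/

open Classical in
/-- The incidency matrix of a graph. -/
noncomputable def incidencyMatrix {V : Type*} (X : SimpleGraph V) : Matrix V V ℂ :=
  X.adjMatrix ℂ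

/-- A cyclic labelling of the vertices by the integers modulo `n`: the translations of `ℤ/n` act by
automorphisms of the graph. -/
def IsCyclicLabelling {V : Type*} {n : ℕ} (X : SimpleGraph V) (label : ZMod n ≃ V) : Prop :=
  ∀ g k l : ZMod n, X.Adj (label (g + k)) (label (g + l)) ↔ X.Adj (label k) (label l)

open Classical in
/-- The polynomial `Q(z) = e(1) z + ⋯ + e(n-1) z^{n-1}`, where `e(k) = 1` if the vertices
labelled `0` and `k` are connected by an edge, and `e(k) = 0` if not. -/
noncomputable def associatedPolynomial {V : Type*} {n : ℕ} (X : SimpleGraph V)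
    (label : ZMod n ≃ V) : Polynomial ℂ :=
  ∑ k ∈ Finset.Ico 1 n,
    Polynomial.C (if X.Adj (label 0) (label (k : ZMod n)) then (1 : ℂ) else 0) * Polynomial.X ^ k

/-! ### The dihedral group, as symmetry group of the `n`-gon -/

/-- The action of the dihedral group on the vertices of the `n`-gon: the rotations act by
`k ↦ i + k`, and the symmetries act by `k ↦ -i - k`. -/
def dihedralHom (n : ℕ) : DihedralGroup n →* Equiv.Perm (ZMod n) :=
  MonoidHom.mk'
    (fun
      | .r i => Equiv.addLeft i
      | .sr i => Equiv.subLeft (-i))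
    (by
      rintro (i | i) (j | j) <;> ext k <;> simp <;> ring)

/-- The group `D_n` of symmetries of the `n`-gon, as a group of permutations of its vertices. It
is a copy of the dihedral group of order `2n` for `n ≥ 3`; for `n = 1` it is trivial, and for
`n = 2` it has two elements. -/
def polygonGroup (n : ℕ) : Subgroup (Equiv.Perm (ZMod n)) := (dihedralHom n).range

noncomputable instance (n : ℕ) [NeZero n] : Fintype (polygonGroup n) := Fintype.ofFinite _

theorem dihedralHom_injective {n : ℕ} (hn : 3 ≤ n) : Function.Injective (dihedralHom n) := by
  have h2 : (2 : ZMod n) ≠ 0 := fun h => by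
    have := (ZMod.natCast_eq_zero_iff 2 n).1 (by exact_mod_cast h)
    exact absurd (Nat.le_of_dvd two_pos this) (by omega)
  rintro (i | i) (j | j) h
  · exact congrArg _ (by simpa [dihedralHom] using Equiv.congr_fun h 0)
  · have h0 : i = -j := by simpa [dihedralHom] using Equiv.congr_fun h 0
    have h1 : i + 1 = -j - 1 := by simpa [dihedralHom] using Equiv.congr_fun h 1
    exact absurd (by linear_combination h1 - h0) h2
  · have h0 : -i = j := by simpa [dihedralHom] using Equiv.congr_fun h 0
    have h1 : -i - 1 = j + 1 := by simpa [dihedralHom] using Equiv.congr_fun h 1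
    exact absurd (by linear_combination h0 - h1) h2
  · exact congrArg _ (by simpa [dihedralHom] using Equiv.congr_fun h 0)

/-!
Write `χ` for the character `k ↦ w ^ k` of `ℤ/n`. In the basis formed by the characters of `ℤ/n`,
the incidency matrix `d` is diagonal, with entries `Q(w ^ k)`, and `Q(w ^ k) = Q(w ^ (-k))`. So if
`Q(1), Q(w), …, Q(w ^ [n/2])` are distinct, then the coaction `v`, which commutes with `d`,
preserves the span of `χ ^ k` and `χ ^ (-k)` for every `k`
(`MagicFourier.coeff_eq_zero_of_ne`, `IsCyclicLabelling.coeff_eq_zero`). In particular `χ` is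
mapped to `χ ⊗ a + χ⁻¹ ⊗ b`. The coaction is multiplicative because `v` is a magic biunitary. For
`n ≠ 4`, expanding the images of `χ ^ 2`, `χ ^ 3` and `χ * χ⁻¹ = 1` gives
`a * b = b * a = 0` (`MagicFourier.coeff_mul_coeff_eq_zero`). As the powers of `χ` span all
functions, the entries of `v` are polynomials in `a` and `b`, and `H(X)` is commutative.

By Gelfand duality, it remains to see which permutation matrices can be obtained from `v` by
applying characters of `H(X)`. There one of the scalars `a` and `b` is zero, hence the permutation is
`k ↦ c + k` or `k ↦ c - k` (`MagicFourier.exists_mem_polygonGroup`). This shows that the canonical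
surjection from `H(X)` to `C(D_n)` is injective (`QuantumSymmetry.toPolygon_injective`). It respects
the Hopf structures because it does so on generators.

The fixed points of the tensor powers of `v` are now the functions on tuples which are
invariant under `D_n`, and their dimension is a number of orbits. Burnside's lemma gives
`2 * c (k + 1) = n ^ k + ε ^ k` (`DihedralGroup.two_mul_card_orbits`), and the Poincaré series is a
sum of two geometric series.
-/

/-! ### Fourier analysis of magic biunitaries over `ℤ/n` -/

namespace MagicFourier

section

variable {n : ℕ} [NeZero n] {B : Type*} [Ring B] [Algebra ℂ B]
  (χ : AddChar (ZMod n) ℂ) (v : Matrix (ZMod n) (ZMod n) B)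

/-- The entries of the image of the character `i ↦ χ (k * i)` under the matrix `v`. -/
def row (k j : ZMod n) : B := ∑ i, χ (k * i) • v j i

/-- The entries of the matrix `v`, written in the basis formed by the characters
`i ↦ χ (k * i)`. Below, "the character `k`" stands for `i ↦ χ (k * i)`, and "its image" for its
image under `v`, in which the character `m` has the coefficient `coeff χ v m k`. -/
noncomputable def coeff (m k : ZMod n) : B :=
  (n : ℂ)⁻¹ • ∑ j, χ (-(m * j)) • row χ v k j

variable {χ} {v}

theorem sum_char_mul_sub (hχ : χ.IsPrimitive) (a b : ZMod n) :
    ∑ m, χ (m * (a - b)) = if a = b then (n : ℂ) else 0 := by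
  have := AddChar.sum_mulShift (a - b) hχ
  simpa only [ZMod.card, sub_eq_zero, Nat.cast_ite, Nat.cast_zero] using this

theorem row_eq_sum_coeff (hχ : χ.IsPrimitive) (k j : ZMod n) :
    row χ v k j = ∑ m, χ (m * j) • coeff χ v m k := by
  have h : ∀ l, ∑ m, χ (m * j) * χ (-(m * l)) = if l = j then (n : ℂ) else 0 := by
    intro l
    simp only [← AddChar.map_add_eq_mul, ← sub_eq_add_neg, ← mul_sub, sum_char_mul_sub hχ,
      eq_comm (a := j)]
  have hn : (n : ℂ) ≠ 0 := NeZero.ne _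
  calc row χ v k j = (n : ℂ)⁻¹ • ∑ l, (if l = j then (n : ℂ) else 0) • row χ v k l := by
        simp [smul_smul, hn]
    _ = _ := by
        simp only [coeff, ← h, Finset.smul_sum, Finset.sum_smul, smul_smul]
        rw [Finset.sum_comm]
        refine Finset.sum_congr rfl fun m _ => Finset.sum_congr rfl fun l _ => ?_
        congr 1; ring

theorem apply_eq_sum_row (hχ : χ.IsPrimitive) (i j : ZMod n) :
    v j i = (n : ℂ)⁻¹ • ∑ k, χ (-(k * i)) • row χ v k j := by
  have h : ∀ l, ∑ k, χ (-(k * i)) * χ (k * l) = if l = i then (n : ℂ) else 0 := by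
    intro l
    simp only [← AddChar.map_add_eq_mul, neg_add_eq_sub, ← mul_sub, sum_char_mul_sub hχ]
  have hn : (n : ℂ) ≠ 0 := NeZero.ne _
  calc v j i = (n : ℂ)⁻¹ • ∑ l, (if l = i then (n : ℂ) else 0) • v j l := by
        simp [smul_smul, hn]
    _ = _ := by
        simp only [row, ← h, Finset.smul_sum, Finset.sum_smul, smul_smul]
        rw [Finset.sum_comm]

/-- The matrix of coefficients intertwines the eigenvalues of a circulant matrix which commutes
with `v`: it can be nonzero only between characters with the same eigenvalue. -/
theorem coeff_eq_zero_of_ne {c : ZMod n → ℂ}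
    (hc : ∀ i j, ∑ k, c (j - k) • v i k = ∑ k, c (k - i) • v k j) {m k : ZMod n}
    (h : ∑ x, c x * χ (m * x) ≠ ∑ x, c x * χ (k * x)) : coeff χ v m k = 0 := by
  have key : ∑ i, ∑ j, χ (k * j - m * i) • ∑ l, c (j - l) • v i l =
      ∑ i, ∑ j, χ (k * j - m * i) • ∑ l, c (l - i) • v l j := by
    simp only [hc]
  have hl : ∑ i, ∑ j, χ (k * j - m * i) • ∑ l, c (j - l) • v i l =
      (∑ x, c x * χ (k * x)) • ∑ i, χ (-(m * i)) • row χ v k i := by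
    rw [Finset.smul_sum]
    refine Finset.sum_congr rfl fun i _ => ?_
    simp only [row, Finset.smul_sum, smul_smul]
    rw [Finset.sum_comm]
    refine Finset.sum_congr rfl fun l _ => ?_
    rw [← Finset.sum_smul, Finset.sum_mul]
    congr 1
    refine Fintype.sum_equiv (Equiv.subRight l) _ _ fun j => ?_
    rw [Equiv.subRight_apply, mul_assoc, ← AddChar.map_add_eq_mul, ← AddChar.map_add_eq_mul,
      mul_comm]
    congr 2; ring
  have hr : ∑ i, ∑ j, χ (k * j - m * i) • ∑ l, c (l - i) • v l j =
      (∑ x, c x * χ (m * x)) • ∑ i, χ (-(m * i)) • row χ v k i := by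
    rw [Finset.smul_sum]
    simp only [row, Finset.smul_sum, smul_smul]
    rw [Finset.sum_comm]
    conv_rhs => rw [Finset.sum_comm]
    refine Finset.sum_congr rfl fun j _ => ?_
    rw [Finset.sum_comm]
    refine Finset.sum_congr rfl fun l _ => ?_
    rw [← Finset.sum_smul, Finset.sum_mul]
    congr 1
    refine Fintype.sum_equiv (Equiv.subLeft l) _ _ fun i => ?_
    rw [Equiv.subLeft_apply, mul_assoc, ← AddChar.map_add_eq_mul, ← AddChar.map_add_eq_mul,
      mul_comm]
    congr 2; ring
  rw [hl, hr, ← sub_eq_zero, ← sub_smul] at key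
  rw [coeff, (smul_eq_zero.1 key).resolve_left (sub_ne_zero.2 (Ne.symm h)), smul_zero]

end

section Multiplicative

variable {n : ℕ} [NeZero n] {B : Type*} [Ring B] [StarRing B] [Algebra ℂ B]
  {χ : AddChar (ZMod n) ℂ} {v : Matrix (ZMod n) (ZMod n) B}

theorem row_zero (hv : IsMagicBiunitary v) (j : ZMod n) : row χ v 0 j = 1 := by
  simp [row, hv.row_sum]

theorem row_add (hv : IsMagicBiunitary v) (k l j : ZMod n) :
    row χ v (k + l) j = row χ v k j * row χ v l j := by
  simp only [row, Finset.sum_mul_sum, smul_mul_smul_comm]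
  refine Finset.sum_congr rfl fun i _ => ?_
  rw [Finset.sum_eq_single i]
  · rw [(hv.isStarProjection j i).isIdempotentElem.eq, ← AddChar.map_add_eq_mul, add_mul]
  · intro i' _ hi
    rw [hv.row_orthogonal j i i' hi.symm, smul_zero]
  · simp

theorem coeff_zero (hv : IsMagicBiunitary v) (hχ : χ.IsPrimitive) (m : ZMod n) :
    coeff χ v m 0 = if m = 0 then 1 else 0 := by
  have := AddChar.sum_mulShift (-m) hχ
  rw [ZMod.card] at this
  have hn : (n : ℂ) ≠ 0 := NeZero.ne _
  simp only [coeff, row_zero hv, ← Finset.sum_smul, smul_smul]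
  simp only [← mul_neg, mul_comm m]
  simp only [mul_neg] at this ⊢
  rw [this]
  split_ifs with h h' h' <;> simp_all

/-- The coefficients of a product of two characters, as a convolution. -/
theorem coeff_add (hv : IsMagicBiunitary v) (hχ : χ.IsPrimitive) (m k l : ZMod n) :
    coeff χ v m (k + l) = ∑ p, coeff χ v p k * coeff χ v (m - p) l := by
  conv_lhs => rw [coeff]
  simp only [row_add hv, row_eq_sum_coeff hχ k, Finset.sum_mul, Finset.smul_sum]
  rw [Finset.sum_comm]
  refine Finset.sum_congr rfl fun p _ => ?_
  rw [coeff.eq_1 χ v (m - p) l]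
  simp only [Finset.mul_sum, Finset.smul_sum, smul_mul_assoc, mul_smul_comm, smul_smul]
  refine Finset.sum_congr rfl fun j _ => ?_
  rw [← AddChar.map_add_eq_mul]
  congr 3; ring

/-- If only the characters `±1` occur in the image of the character `1`, then convolution with
the coefficients of `±1` has two terms. -/
theorem coeff_add_of_support (hv : IsMagicBiunitary v) (hχ : χ.IsPrimitive)
    (hs : ∀ m k : ZMod n, m ≠ k → m ≠ -k → coeff χ v m k = 0) (h2 : (2 : ZMod n) ≠ 0)
    (m l : ZMod n) :
    coeff χ v m (1 + l) =
      coeff χ v 1 1 * coeff χ v (m - 1) l + coeff χ v (-1) 1 * coeff χ v (m + 1) l := by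
  have h1 : (1 : ZMod n) ≠ -1 := fun h => h2 (by linear_combination h)
  rw [coeff_add hv hχ, Finset.sum_eq_add 1 (-1) h1, sub_neg_eq_add]
  · rintro p _ ⟨hp, hp'⟩
    rw [hs p 1 hp hp', zero_mul]
  · simp
  · simp

/-- The coefficients of the image of the character `1` are pairwise orthogonal. This is where
`n ≠ 4` matters: for `n = 4` the characters `2` and `-2` coincide, and there is no obstruction to
noncommuting coefficients. -/
theorem coeff_mul_coeff_eq_zero (hn : n ≠ 4) (hv : IsMagicBiunitary v) (hχ : χ.IsPrimitive)
    (hs : ∀ m k : ZMod n, m ≠ k → m ≠ -k → coeff χ v m k = 0) {p q : ZMod n} (hpq : p ≠ q) :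
    coeff χ v p 1 * coeff χ v q 1 = 0 := by
  by_cases hp : p ≠ 1 ∧ p ≠ -1
  · rw [hs p 1 hp.1 hp.2, zero_mul]
  by_cases hq : q ≠ 1 ∧ q ≠ -1
  · rw [hs q 1 hq.1 hq.2, mul_zero]
  have h1 : (1 : ZMod n) ≠ -1 := by grind
  have h2 : (2 : ZMod n) ≠ 0 := fun h => h1 (by linear_combination h)
  have h4 : (4 : ZMod n) ≠ 0 := fun h => by
    have h4 : n ∣ 4 := (ZMod.natCast_eq_zero_iff 4 n).1 (by exact_mod_cast h)
    have h2 : ¬ n ∣ 2 := fun h => h2 (by exact_mod_cast (ZMod.natCast_eq_zero_iff 2 n).2 h)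
    have := Nat.le_of_dvd (by norm_num) h4
    interval_cases n <;> omega
  have step := coeff_add_of_support hv hχ hs h2
  set a := coeff χ v 1 1
  set b := coeff χ v (-1) 1
  have e3 : coeff χ v 3 1 = 0 :=
    hs _ _ (fun h => h2 (by linear_combination h)) (fun h => h4 (by linear_combination h))
  have e3' : coeff χ v (-3) 1 = 0 :=
    hs _ _ (fun h => h4 (by linear_combination -h)) (fun h => h2 (by linear_combination -h))
  have e02 : coeff χ v 0 2 = 0 :=
    hs _ _ (fun h => h2 (by linear_combination -h)) (fun h => h2 (by linear_combination h))
  have e13 : coeff χ v (-1) 3 = 0 :=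
    hs _ _ (fun h => h4 (by linear_combination -h)) (fun h => h2 (by linear_combination h))
  have e3'' : coeff χ v (-3) (-1) = 0 :=
    hs _ _ (fun h => h2 (by linear_combination -h)) (fun h => h4 (by linear_combination -h))
  -- the image of the square of the character `1` does not involve the trivial character
  have hab : a * b + b * a = 0 := by
    have := step 0 1
    rwa [one_add_one_eq_two, e02, zero_sub, zero_add, eq_comm] at this
  -- the image of its cube involves only the characters `±3`
  have habb : a * (b * b) = 0 := by
    have s3 := step (-1) 2
    have s2 := step (-2) 1
    rw [show (1 : ZMod n) + 2 = 3 by ring, show (-1 : ZMod n) - 1 = -2 by ring,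
      neg_add_cancel, e13, e02, mul_zero, add_zero] at s3
    rw [show (1 : ZMod n) + 1 = 2 by ring, show (-2 : ZMod n) - 1 = -3 by ring,
      show (-2 : ZMod n) + 1 = -1 by ring, e3', mul_zero, zero_add] at s2
    rw [← s2, ← s3]
  -- the two coefficients of the inverse character give an inverse of the image of `1`
  have hone : a * coeff χ v (-1) (-1) + b * coeff χ v 1 (-1) = 1 := by
    have := step 0 (-1)
    rwa [add_neg_cancel, coeff_zero hv hχ, if_pos rfl, zero_sub, zero_add, eq_comm] at this
  have hba : b * coeff χ v (-1) (-1) = 0 := by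
    have := step (-2) (-1)
    rwa [add_neg_cancel, coeff_zero hv hχ, if_neg (neg_ne_zero.2 h2),
      show (-2 : ZMod n) - 1 = -3 by ring, show (-2 : ZMod n) + 1 = -1 by ring, e3'', mul_zero,
      zero_add, eq_comm] at this
  have hab0 : a * b = 0 := by
    calc a * b = a * b * (a * coeff χ v (-1) (-1) + b * coeff χ v 1 (-1)) := by
          rw [hone, mul_one]
      _ = a * (a * b + b * a) * coeff χ v (-1) (-1) - a * a * (b * coeff χ v (-1) (-1))
          + a * (b * b) * coeff χ v 1 (-1) := by noncomm_ring
      _ = 0 := by rw [hab, hba, habb]; simp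
  have hba0 : b * a = 0 := by rwa [hab0, zero_add] at hab
  have : (p = 1 ∧ q = -1) ∨ (p = -1 ∧ q = 1) := by grind
  rcases this with ⟨rfl, rfl⟩ | ⟨rfl, rfl⟩
  · exact hab0
  · exact hba0

/-- The entries of `v` lie in the subalgebra generated by the coefficients of the image of the
character `1`, since the powers of this character span all functions. -/
theorem apply_mem_adjoin (hv : IsMagicBiunitary v) (hχ : χ.IsPrimitive) (i j : ZMod n) :
    v i j ∈ Algebra.adjoin ℂ (Set.range fun p => coeff χ v p 1) := by
  have h1 : row χ v 1 i ∈ Algebra.adjoin ℂ (Set.range fun p => coeff χ v p 1) := by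
    rw [row_eq_sum_coeff hχ]
    exact sum_mem fun m _ => Subalgebra.smul_mem _ (Algebra.subset_adjoin (Set.mem_range_self m)) _
  have hk : ∀ k : ℕ, row χ v k i ∈ Algebra.adjoin ℂ (Set.range fun p => coeff χ v p 1) := by
    intro k
    induction k with
    | zero => rw [Nat.cast_zero, row_zero hv]; exact one_mem _
    | succ k ih => rw [Nat.cast_succ, row_add hv]; exact mul_mem ih h1
  rw [apply_eq_sum_row (v := v) hχ]
  refine Subalgebra.smul_mem _ (sum_mem fun k _ => Subalgebra.smul_mem _ ?_ _) _
  simpa using hk k.val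

theorem commute_apply (hn : n ≠ 4) (hv : IsMagicBiunitary v) (hχ : χ.IsPrimitive)
    (hs : ∀ m k : ZMod n, m ≠ k → m ≠ -k → coeff χ v m k = 0) (i j i' j' : ZMod n) :
    v i j * v i' j' = v i' j' * v i j := by
  have hc : ∀ a ∈ Set.range fun p => coeff χ v p 1, ∀ b ∈ Set.range fun p => coeff χ v p 1,
      a * b = b * a := by
    rintro _ ⟨p, rfl⟩ _ ⟨q, rfl⟩
    by_cases hpq : p = q
    · rw [hpq]
    · simp only [coeff_mul_coeff_eq_zero hn hv hχ hs hpq,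
        coeff_mul_coeff_eq_zero hn hv hχ hs (Ne.symm hpq)]
  exact congrArg Subtype.val ((Algebra.isMulCommutative_adjoin ℂ hc).is_comm.comm
    ⟨v i j, apply_mem_adjoin hv hχ i j⟩ ⟨v i' j', apply_mem_adjoin hv hχ i' j'⟩)

end Multiplicative

end MagicFourier

/-! ### The dihedral group and magic biunitaries over `ℂ` -/

theorem mem_polygonGroup_iff {n : ℕ} {σ : Equiv.Perm (ZMod n)} :
    σ ∈ polygonGroup n ↔ (∃ c, ∀ k, σ k = c + k) ∨ ∃ c, ∀ k, σ k = c - k := by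
  constructor
  · rintro ⟨i | i, rfl⟩
    · exact Or.inl ⟨i, fun k => rfl⟩
    · exact Or.inr ⟨-i, fun k => rfl⟩
  · rintro (⟨c, hc⟩ | ⟨c, hc⟩)
    · exact ⟨.r c, Equiv.ext fun k => (hc k).symm⟩
    · refine ⟨.sr (-c), Equiv.ext fun k => ?_⟩
      rw [hc k]
      simp [dihedralHom]

theorem IsMagicBiunitary.reindex {V W : Type*} [Fintype V] [Fintype W] {B : Type*} [Ring B]
    [StarRing B] {u : Matrix V V B} (hu : IsMagicBiunitary u) (e : W ≃ V) :
    IsMagicBiunitary (u.submatrix e e) where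
  isStarProjection _ _ := hu.isStarProjection _ _
  row_orthogonal _ _ _ h := hu.row_orthogonal _ _ _ (e.injective.ne h)
  col_orthogonal _ _ _ h := hu.col_orthogonal _ _ _ (e.injective.ne h)
  row_sum i := (e.sum_comp fun j => u (e i) j).trans (hu.row_sum _)
  col_sum j := (e.sum_comp fun i => u i (e j)).trans (hu.col_sum _)

theorem IsMagicBiunitary.map {V : Type*} [Fintype V] {B C : Type*} [Ring B] [StarRing B]
    [Algebra ℂ B] [Ring C] [StarRing C] [Algebra ℂ C] {u : Matrix V V B}
    (hu : IsMagicBiunitary u) (φ : B →⋆ₐ[ℂ] C) : IsMagicBiunitary (u.map φ) where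
  isStarProjection i j := (hu.isStarProjection i j).map φ
  row_orthogonal i j k h := by simp [← map_mul, hu.row_orthogonal i j k h]
  col_orthogonal i j k h := by simp [← map_mul, hu.col_orthogonal i j k h]
  row_sum i := by simp [← map_sum, hu.row_sum]
  col_sum j := by simp [← map_sum, hu.col_sum]

/-- A magic biunitary over `ℂ` is a permutation matrix. -/
theorem IsMagicBiunitary.exists_forall_eq_ite {V : Type*} [Fintype V] [DecidableEq V]
    {u : Matrix V V ℂ} (hu : IsMagicBiunitary u) :
    ∃ τ : V → V, ∀ i j, u i j = if τ i = j then 1 else 0 := by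
  have h01 : ∀ i j, u i j = 0 ∨ u i j = 1 := fun i j =>
    IsIdempotentElem.iff_eq_zero_or_one.1 (hu.isStarProjection i j).isIdempotentElem
  have hex : ∀ i, ∃ j, u i j = 1 := by
    intro i
    by_contra! h
    have := hu.row_sum i
    rw [Finset.sum_eq_zero fun j _ => (h01 i j).resolve_right (h j)] at this
    exact zero_ne_one this
  choose τ hτ using hex
  refine ⟨τ, fun i j => ?_⟩
  split_ifs with h
  · rw [← h, hτ]
  · simpa [hτ] using hu.row_orthogonal i (τ i) j h

namespace MagicFourier

variable {n : ℕ} [NeZero n] {χ : AddChar (ZMod n) ℂ}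

/-- A magic biunitary over `ℂ` which preserves the span of the characters `±1` is the matrix of
an element of the dihedral group: by orthogonality of the coefficients, the character `1` is
mapped to a multiple of `1` or of `-1`. -/
theorem exists_mem_polygonGroup {u : Matrix (ZMod n) (ZMod n) ℂ} (hn : n ≠ 4)
    (hu : IsMagicBiunitary u) (hχ : χ.IsPrimitive)
    (hs : ∀ m k : ZMod n, m ≠ k → m ≠ -k → coeff χ u m k = 0) :
    ∃ σ ∈ polygonGroup n, ∀ i j, u i j = if σ j = i then 1 else 0 := by
  obtain ⟨τ, hτ⟩ := hu.exists_forall_eq_ite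
  have hrow : ∀ i, row χ u 1 i = χ (τ i) := fun i => by simp [row, hτ]
  have hinj : Function.Injective χ := fun a b hab => by
    rw [← sub_eq_zero, ← hχ.zmod_char_eq_one_iff, AddChar.map_sub_eq_div, hab,
      div_self ((χ.val_isUnit b).ne_zero)]
  obtain ⟨p, hp⟩ : ∃ p, coeff χ u p 1 ≠ 0 := by
    by_contra! h
    have := hrow 0
    rw [row_eq_sum_coeff hχ] at this
    simp only [h, smul_zero, Finset.sum_const_zero] at this
    exact (χ.val_isUnit _).ne_zero this.symm
  have hτp : ∀ i, χ (τ i) = χ (p * i) * coeff χ u p 1 := by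
    intro i
    rw [← hrow, row_eq_sum_coeff hχ, Finset.sum_eq_single p, smul_eq_mul]
    · intro q _ hq
      rw [(mul_eq_zero.1 (coeff_mul_coeff_eq_zero hn hu hχ hs hq)).resolve_right hp, smul_zero]
    · simp
  have hτ0 : ∀ i, τ i = p * i + τ 0 := by
    intro i
    apply hinj
    rw [AddChar.map_add_eq_mul, hτp, hτp 0, mul_zero, AddChar.map_zero_eq_one, one_mul]
  have hp1 : p = 1 ∨ p = -1 := by
    by_contra! h
    exact hp (hs p 1 h.1 h.2)
  rcases hp1 with rfl | rfl
  · refine ⟨Equiv.addLeft (-τ 0), mem_polygonGroup_iff.2 (Or.inl ⟨-τ 0, fun k => rfl⟩),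
      fun i j => ?_⟩
    rw [hτ, hτ0]
    congr 1
    simp only [Equiv.coe_addLeft]
    rw [one_mul, neg_add_eq_sub, sub_eq_iff_eq_add]
    exact propext eq_comm
  · refine ⟨Equiv.subLeft (τ 0), mem_polygonGroup_iff.2 (Or.inr ⟨τ 0, fun k => rfl⟩),
      fun i j => ?_⟩
    rw [hτ, hτ0]
    congr 1
    rw [Equiv.subLeft_apply, neg_one_mul, neg_add_eq_sub, sub_eq_iff_eq_add, sub_eq_iff_eq_add,
      add_comm]

end MagicFourier

/-! ### Cyclic graphs -/

namespace IsCyclicLabelling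

variable {V : Type*} {n : ℕ} {X : SimpleGraph V} {label : ZMod n ≃ V}

theorem adj_iff (hX : IsCyclicLabelling X label) (a b : ZMod n) :
    X.Adj (label a) (label b) ↔ X.Adj (label 0) (label (b - a)) := by
  simpa using hX a 0 (b - a)

theorem adj_neg_iff (hX : IsCyclicLabelling X label) (a : ZMod n) :
    X.Adj (label 0) (label (-a)) ↔ X.Adj (label 0) (label a) := by
  rw [X.adj_comm (label 0) (label a), hX.adj_iff a 0, zero_sub]

theorem adj_perm_iff (hX : IsCyclicLabelling X label) {σ : Equiv.Perm (ZMod n)}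
    (hσ : σ ∈ polygonGroup n) (a b : ZMod n) :
    X.Adj (label (σ a)) (label (σ b)) ↔ X.Adj (label a) (label b) := by
  rcases mem_polygonGroup_iff.1 hσ with ⟨c, hc⟩ | ⟨c, hc⟩
  · rw [hc, hc, hX]
  · rw [hc, hc, hX.adj_iff, hX.adj_iff a b, ← hX.adj_neg_iff]
    simp

variable [NeZero n]

open Classical in
theorem eval_associatedPolynomial {w : ℂ} (hw : w ^ n = 1) (k : ℕ) :
    (associatedPolynomial X label).eval (w ^ k) =
      ∑ x, (if X.Adj (label 0) (label x) then (1 : ℂ) else 0) *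
        AddChar.zmodChar n hw (k * x) := by
  have h0 : ∑ x ∈ Finset.range n, (if X.Adj (label 0) (label (x : ZMod n)) then (1 : ℂ) else 0) *
      AddChar.zmodChar n hw (k * (x : ZMod n)) = (associatedPolynomial X label).eval (w ^ k) := by
    rw [associatedPolynomial, Polynomial.eval_finsetSum, Finset.range_eq_Ico,
      Finset.sum_eq_sum_Ico_succ_bot (NeZero.pos n)]
    simp only [Nat.cast_zero, SimpleGraph.irrefl, if_false, zero_mul, zero_add]
    refine Finset.sum_congr rfl fun x _ => ?_
    rw [← Nat.cast_mul, AddChar.zmodChar_apply', Polynomial.eval_mul, Polynomial.eval_C,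
      Polynomial.eval_pow, Polynomial.eval_X, pow_mul]
  rw [← h0]
  refine Finset.sum_bij' (fun x _ => (x : ZMod n)) (fun x _ => x.val) ?_ ?_ ?_ ?_ ?_
  · simp
  · exact fun x _ => Finset.mem_range.2 x.val_lt
  · exact fun x hx => ZMod.val_cast_of_lt (Finset.mem_range.1 hx)
  · simp
  · simp

/-- If the numbers `Q(1), Q(w), …, Q(w ^ [n/2])` are distinct, then a matrix which commutes with
the incidency matrix preserves the spans of the characters `k` and `-k`. -/
theorem coeff_eq_zero [Fintype V] (hX : IsCyclicLabelling X label) {w : ℂ}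
    (hw : w ^ n = 1)
    (hQ : Set.InjOn (fun k : ℕ => (associatedPolynomial X label).eval (w ^ k)) (Set.Iic (n / 2)))
    {B : Type*} [Ring B] [Algebra ℂ B] {v : Matrix V V B}
    (hd : CommutesWith v (incidencyMatrix X)) {m k : ZMod n} (hmk : m ≠ k) (hmk' : m ≠ -k) :
    MagicFourier.coeff (AddChar.zmodChar n hw) (v.submatrix label label) m k = 0 := by
  classical
  set c : ZMod n → ℂ := fun x => if X.Adj (label 0) (label x) then (1 : ℂ) else 0 with hc
  have hinc : ∀ a b, incidencyMatrix X (label a) (label b) = c (b - a) := by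
    intro a b
    simp only [incidencyMatrix, SimpleGraph.adjMatrix_apply, hX.adj_iff a b, hc]
  refine MagicFourier.coeff_eq_zero_of_ne (c := c) (fun i j => ?_) fun h => ?_
  · have := (commutesWith_iff _ _).1 hd (label i) (label j)
    rw [← label.sum_comp, ← label.sum_comp] at this
    simpa only [hinc, Matrix.submatrix_apply] using this
  · have hcneg : ∀ x, c (-x) = c x := fun x => by simp only [hc, hX.adj_neg_iff]
    -- every eigenvalue is one of `Q(1), …, Q(w ^ [n/2])`, since `Q(w ^ m) = Q(w ^ (-m))`
    have heven : ∀ m : ZMod n, ∑ x, c x * AddChar.zmodChar n hw (m * x) =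
        (associatedPolynomial X label).eval (w ^ m.valMinAbs.natAbs) := by
      intro m
      rw [eval_associatedPolynomial hw, ZMod.natCast_natAbs_valMinAbs]
      split_ifs
      · rfl
      · rw [← Equiv.sum_comp (Equiv.neg _)]
        refine Finset.sum_congr rfl fun x _ => ?_
        rw [Equiv.neg_apply, hcneg, mul_neg, neg_mul]
    rw [heven, heven] at h
    rcases ZMod.natAbs_valMinAbs_eq_natAbs_valMinAbs.1
      (hQ (ZMod.natAbs_valMinAbs_le m) (ZMod.natAbs_valMinAbs_le k) h) with h | h
    · exact hmk h
    · exact hmk' h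

end IsCyclicLabelling

/-! ### The isomorphism with the algebra of functions on the dihedral group -/

/-- The characters of a commutative C⋆-algebra separate its points. -/
theorem CStarAlgebra.eq_of_forall_starAlgHom {A : Type*} [CStarAlgebra A]
    (hA : ∀ a b : A, a * b = b * a) {a b : A} (h : ∀ φ : A →⋆ₐ[ℂ] ℂ, φ a = φ b) : a = b := by
  let _ : CommCStarAlgebra A := { (inferInstance : CStarAlgebra A) with mul_comm := hA }
  refine (gelfandTransform_isometry A).injective (ContinuousMap.ext fun φ => ?_)
  exact h (StarAlgHomClass.toStarAlgHom φ)

namespace QuantumSymmetry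

section

variable {V : Type*} [Fintype V] {d : Matrix V V ℂ}

/-- A closed property of the elements of `H(X,d)` has to be checked only on scalars and generators,
and for sums and products. -/
theorem induction_on {P : QuantumSymmetry d → Prop} (a : QuantumSymmetry d)
    (closed : IsClosed {a | P a}) (scalar : ∀ c : ℂ, P (algebraMap ℂ _ c))
    (coaction : ∀ i j, P (coaction d i j)) (add : ∀ a b, P a → P b → P (a + b))
    (mul : ∀ a b, P a → P b → P (a * b)) : P a := by
  refine (denseRange_ofFree d).induction_on a closed fun f => ?_
  induction f using TensorProduct.induction_on with
  | zero => simpa using scalar 0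
  | add f g hf hg => rw [map_add]; exact add _ _ hf hg
  | tmul c f =>
    have hc : c ⊗ₜ[ℝ] f = c • ((1 : ℂ) ⊗ₜ[ℝ] f) := by simp [TensorProduct.smul_tmul']
    rw [hc, map_smul, Algebra.smul_def]
    refine mul _ _ (scalar c) ?_
    induction f using FreeAlgebra.induction with
    | grade0 r =>
      have hr : (1 : ℂ) ⊗ₜ[ℝ] (algebraMap ℝ (FreeAlgebra ℝ (V × V)) r) =
          algebraMap ℂ (FreeStarAlgebra (V × V)) r := by
        rw [Algebra.algebraMap_eq_smul_one, Algebra.algebraMap_eq_smul_one,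
          Algebra.TensorProduct.one_def, TensorProduct.tmul_smul]
        simp [TensorProduct.smul_tmul']
      rw [hr, AlgHomClass.commutes]
      exact scalar _
    | grade1 ij => exact coaction ij.1 ij.2
    | mul f g hf hg =>
      have hfg : (1 : ℂ) ⊗ₜ[ℝ] (f * g) = (1 ⊗ₜ[ℝ] f) * ((1 : ℂ) ⊗ₜ[ℝ] g) := by simp
      rw [hfg, map_mul]
      exact mul _ _ (hf (by simp [TensorProduct.smul_tmul']))
        (hg (by simp [TensorProduct.smul_tmul']))
    | add f g hf hg =>
      rw [TensorProduct.tmul_add, map_add]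
      exact add _ _ (hf (by simp [TensorProduct.smul_tmul']))
        (hg (by simp [TensorProduct.smul_tmul']))

open scoped CStarAlgebra in
theorem hom_ext {B : Type*} [CStarAlgebra B] {φ ψ : QuantumSymmetry d →⋆ₐ[ℂ] B}
    (h : ∀ i j, φ (coaction d i j) = ψ (coaction d i j)) : φ = ψ := by
  refine StarAlgHom.ext fun a => ?_
  refine induction_on (P := fun a => φ a = ψ a) a
    (isClosed_eq (map_continuous φ) (map_continuous ψ)) (fun c => ?_) h (fun a b ha hb => ?_)
    (fun a b ha hb => ?_)
  · rw [AlgHomClass.commutes, AlgHomClass.commutes]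
  · rw [map_add, map_add, ha, hb]
  · rw [map_mul, map_mul, ha, hb]

theorem mul_comm_of_coaction
    (h : ∀ i j k l, coaction d i j * coaction d k l = coaction d k l * coaction d i j)
    (a b : QuantumSymmetry d) : a * b = b * a := by
  refine induction_on (P := fun a => a * b = b * a) a
    (isClosed_eq (continuous_mul_const b) (continuous_const_mul b))
    (fun c => Algebra.commutes c b) (fun i j => ?_) (fun a a' ha ha' => ?_)
    (fun a a' ha ha' => ?_)
  · refine induction_on (P := fun b => coaction d i j * b = b * coaction d i j) b
      (isClosed_eq (continuous_const_mul _) (continuous_mul_const _))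
      (fun c => (Algebra.commutes c _).symm) (fun k l => h i j k l) (fun a a' ha ha' => ?_)
      (fun a a' ha ha' => ?_)
    · rw [mul_add, add_mul, ha, ha']
    · rw [← mul_assoc, ha, mul_assoc, ha', mul_assoc]
  · rw [mul_add, add_mul, ha, ha']
  · rw [mul_assoc, ha', ← mul_assoc, ha, mul_assoc]

end

section Polygon

variable {V : Type*} {X : SimpleGraph V} {n : ℕ}

/-- The matrix of the action of `D_n` on the labelled set `V`, with entries in `C(D_n)`. -/
def polygonMatrix (label : ZMod n ≃ V) : Matrix V V (polygonGroup n → ℂ) :=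
  Matrix.of fun i j σ => if σ.1 (label.symm j) = label.symm i then (1 : ℂ) else 0

theorem polygonMatrix_label (label : ZMod n ≃ V) (a b : ZMod n) (σ : polygonGroup n) :
    polygonMatrix label (label a) (label b) σ = if σ.1 b = a then 1 else 0 := by
  simp [polygonMatrix]

variable [Fintype V] [NeZero n]

theorem isMagicBiunitary_polygonMatrix (label : ZMod n ≃ V) :
    IsMagicBiunitary (polygonMatrix label) where
  isStarProjection i j := by
    refine ⟨funext fun σ => ?_, funext fun σ => ?_⟩
    · simp [polygonMatrix]
    · simp [polygonMatrix, apply_ite]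
  row_orthogonal i j k h := funext fun σ => by
    simp only [polygonMatrix, Matrix.of_apply, Pi.mul_apply, Pi.zero_apply, mul_ite, mul_one,
      mul_zero, ite_eq_right_iff, one_ne_zero, imp_false]
    intro h1 h2
    exact h (label.symm.injective (σ.1.injective (h2.trans h1.symm)))
  col_orthogonal i j k h := funext fun σ => by
    simp only [polygonMatrix, Matrix.of_apply, Pi.mul_apply, Pi.zero_apply, mul_ite, mul_one,
      mul_zero, ite_eq_right_iff, one_ne_zero, imp_false]
    intro h1 h2
    exact h (label.symm.injective (h2.symm.trans h1))
  row_sum i := funext fun σ => by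
    rw [Finset.sum_apply, ← label.sum_comp]
    simp [polygonMatrix, ← Equiv.eq_symm_apply]
  col_sum j := funext fun σ => by
    rw [Finset.sum_apply, ← label.sum_comp]
    simp [polygonMatrix]

theorem commutesWith_polygonMatrix {label : ZMod n ≃ V} (hX : IsCyclicLabelling X label) :
    CommutesWith (polygonMatrix label) (incidencyMatrix X) := by
  rw [commutesWith_iff]
  intro i j
  obtain ⟨a, rfl⟩ := label.surjective i
  obtain ⟨b, rfl⟩ := label.surjective j
  ext σ
  rw [Finset.sum_apply, Finset.sum_apply, ← label.sum_comp, ← label.sum_comp]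
  simp only [Pi.smul_apply, polygonMatrix_label, smul_eq_mul, mul_ite, mul_one, mul_zero,
    ← Equiv.eq_symm_apply, Finset.sum_ite_eq', Finset.mem_univ, if_true]
  simp only [Equiv.eq_symm_apply, Finset.sum_ite_eq, Finset.mem_univ, if_true]
  have := hX.adj_perm_iff σ.2 (σ.1.symm a) b
  rw [Equiv.apply_symm_apply] at this
  simp only [incidencyMatrix, SimpleGraph.adjMatrix_apply]
  split_ifs <;> tauto

/-- The restriction to the dihedral group, as a morphism from `H(X)` to `C(D_n)`: it is defined by
the universal property of `H(X)`, applied to the matrix of the action of `D_n`. -/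
noncomputable def toPolygon {label : ZMod n ≃ V} (hX : IsCyclicLabelling X label) :
    QuantumSymmetry (incidencyMatrix X) →⋆ₐ[ℂ] (polygonGroup n → ℂ) :=
  lift (isMagicBiunitary_polygonMatrix label) (commutesWith_polygonMatrix hX)

variable {label : ZMod n ≃ V} (hX : IsCyclicLabelling X label)

theorem toPolygon_coaction (a b : ZMod n) :
    toPolygon hX (coaction (incidencyMatrix X) (label a) (label b)) =
      fun σ : polygonGroup n => if σ.1 b = a then (1 : ℂ) else 0 := by
  rw [toPolygon, lift_coaction]
  exact funext fun σ => polygonMatrix_label label a b σ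

theorem toPolygon_surjective : Function.Surjective (toPolygon hX) := by
  classical
  let R : Subalgebra ℂ (polygonGroup n → ℂ) := (toPolygon hX).toAlgHom.range
  have hgen : ∀ a b : ZMod n, (fun σ : polygonGroup n => if σ.1 b = a then (1 : ℂ) else 0) ∈ R :=
    fun a b => ⟨_, toPolygon_coaction hX a b⟩
  -- the characteristic function of `σ` is the product of those of the conditions `τ b = σ b`
  have hsingle : ∀ σ : polygonGroup n, (Pi.single σ 1 : polygonGroup n → ℂ) ∈ R := by
    intro σ
    have := prod_mem (t := Finset.univ) fun (b : ZMod n) _ => hgen (σ.1 b) b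
    convert this using 1
    ext τ
    rw [Finset.prod_apply, Pi.single_apply]
    split_ifs with h
    · simp [h]
    · obtain ⟨b, hb⟩ : ∃ b, τ.1 b ≠ σ.1 b := by
        by_contra! h'
        exact h (Subtype.ext (Equiv.ext h'))
      exact (Finset.prod_eq_zero (Finset.mem_univ b) (if_neg hb)).symm
  intro f
  have hf : f ∈ R := by
    rw [show f = ∑ σ, f σ • (Pi.single σ 1 : polygonGroup n → ℂ) by
      ext τ; simp [Finset.sum_apply, Pi.single_apply]]
    exact sum_mem fun σ _ => R.smul_mem (hsingle σ) _
  exact hf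

/-- Injectivity: since `H(X)` is commutative, it suffices to consider the characters of `H(X)`,
and these are given by elements of the dihedral group. -/
theorem toPolygon_injective (hn : n ≠ 4) {w : ℂ} (hw : IsPrimitiveRoot w n)
    (hQ : Set.InjOn (fun k : ℕ => (associatedPolynomial X label).eval (w ^ k))
      (Set.Iic (n / 2))) : Function.Injective (toPolygon hX) := by
  have hχ := AddChar.zmodChar_primitive_of_primitive_root n hw
  have hmagic := isMagicBiunitary_coaction (incidencyMatrix X)
  have hcomm : ∀ a b : QuantumSymmetry (incidencyMatrix X), a * b = b * a := by
    refine mul_comm_of_coaction fun i j k l => ?_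
    have := MagicFourier.commute_apply hn (hmagic.reindex label) hχ
      (fun m k => hX.coeff_eq_zero hw.pow_eq_one hQ (commutesWith_coaction _))
      (label.symm i) (label.symm j) (label.symm k) (label.symm l)
    simpa using this
  intro a b hab
  refine CStarAlgebra.eq_of_forall_starAlgHom hcomm fun φ => ?_
  have hd : CommutesWith ((coaction (incidencyMatrix X)).map φ) (incidencyMatrix X) := by
    have := (commutesWith_iff _ _).1 (commutesWith_coaction (incidencyMatrix X))
    rw [commutesWith_iff]
    intro i j
    simpa [map_sum, map_smul] using congrArg φ (this i j)
  obtain ⟨σ, hσ, h⟩ := MagicFourier.exists_mem_polygonGroup hn ((hmagic.map φ).reindex label) hχ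
    fun m k => hX.coeff_eq_zero hw.pow_eq_one hQ hd
  have hφ : φ = ((Pi.evalStarAlgHom ℂ (fun _ : polygonGroup n => ℂ) ⟨σ, hσ⟩).comp
      (toPolygon hX)) := by
    refine hom_ext fun i j => ?_
    obtain ⟨a, rfl⟩ := label.surjective i
    obtain ⟨b, rfl⟩ := label.surjective j
    rw [StarAlgHom.comp_apply, toPolygon_coaction]
    exact h a b
  rw [hφ, StarAlgHom.comp_apply, StarAlgHom.comp_apply, hab]

end Polygon

end QuantumSymmetry

/-! ### Compatibility with the Hopf structures -/

namespace FunctionAlgebra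

variable {G : Type*} [Fintype G]

open Classical in
theorem tmul_eq_sum (f f' : G → ℂ) : MaxTensor.tmul f f' =
    ∑ g, ∑ h, (f g * f' h) •
      MaxTensor.tmul (Pi.single g 1 : G → ℂ) (Pi.single h 1 : G → ℂ) := by
  have hf : ∀ f : G → ℂ, f = ∑ g, f g • (Pi.single g 1 : G → ℂ) := fun f => by
    ext g
    simp [Finset.sum_apply, Pi.single_apply]
  conv_lhs => rw [hf f, hf f', MaxTensor.sum_tmul]
  simp only [MaxTensor.tmul_sum, MaxTensor.smul_tmul, MaxTensor.tmul_smul, smul_smul,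
    mul_comm]

variable [Group G]

theorem comul_add (f f' : G → ℂ) : comul (f + f') = comul f + comul f' := by
  simp only [comul, Pi.add_apply, add_smul, Finset.sum_add_distrib]

theorem comul_mul (f f' : G → ℂ) : comul (f * f') = comul f * comul f' := by
  classical
  simp only [comul, Finset.sum_mul_sum, smul_mul_smul_comm, MaxTensor.tmul_mul_tmul]
  refine Finset.sum_congr rfl fun g _ => ?_
  rw [eq_comm, Finset.sum_eq_single g]
  · refine Finset.sum_congr rfl fun h _ => ?_
    rw [Finset.sum_eq_single h]
    · simp [← Pi.single_mul]
    · intro h' _ hh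
      simp [← Pi.single_mul_left, hh.symm, MaxTensor.tmul_zero]
    · simp
  · intro g' _ hg
    refine Finset.sum_eq_zero fun h _ => Finset.sum_eq_zero fun h' _ => ?_
    simp [← Pi.single_mul_left, hg.symm, MaxTensor.zero_tmul]
  · simp

theorem comul_algebraMap (c : ℂ) :
    comul (algebraMap ℂ (G → ℂ) c) = algebraMap ℂ (MaxTensor (G → ℂ) (G → ℂ)) c := by
  classical
  rw [Algebra.algebraMap_eq_smul_one (A := MaxTensor (G → ℂ) (G → ℂ)) c,
    ← MaxTensor.one_tmul_one, tmul_eq_sum]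
  simp [comul, Finset.smul_sum]

theorem continuous_comul : Continuous (comul : (G → ℂ) → MaxTensor (G → ℂ) (G → ℂ)) := by
  unfold comul
  fun_prop

end FunctionAlgebra

namespace QuantumSymmetry

variable {V : Type*} [Fintype V] {X : SimpleGraph V} {n : ℕ} [NeZero n] {label : ZMod n ≃ V}
  (hX : IsCyclicLabelling X label)

theorem comul_toPolygon_coaction (a b : ZMod n) :
    FunctionAlgebra.comul (toPolygon hX (coaction (incidencyMatrix X) (label a) (label b))) =
      ∑ c, MaxTensor.tmul (toPolygon hX (coaction (incidencyMatrix X) (label a) (label c)))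
        (toPolygon hX (coaction (incidencyMatrix X) (label c) (label b))) := by
  rw [FunctionAlgebra.comul]
  conv_rhs =>
    enter [2, c]
    rw [FunctionAlgebra.tmul_eq_sum]
  simp only [toPolygon_coaction]
  conv_rhs => rw [Finset.sum_comm]
  refine Finset.sum_congr rfl fun g _ => ?_
  rw [Finset.sum_comm]
  refine Finset.sum_congr rfl fun h _ => ?_
  rw [← Finset.sum_smul]
  congr 1
  simp
  congr

open scoped CStarAlgebra

theorem map_comul_eq (h : QuantumSymmetry (incidencyMatrix X)) :
    MaxTensor.map (toPolygon hX) (toPolygon hX) (comul (incidencyMatrix X) h) =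
      FunctionAlgebra.comul (toPolygon hX h) := by
  refine induction_on (P := fun h => MaxTensor.map (toPolygon hX) (toPolygon hX)
      (comul (incidencyMatrix X) h) = FunctionAlgebra.comul (toPolygon hX h)) h
    (isClosed_eq ((map_continuous _).comp (map_continuous _))
      (FunctionAlgebra.continuous_comul.comp (map_continuous _)))
    (fun c => ?_) (fun i j => ?_) (fun a b ha hb => ?_) (fun a b ha hb => ?_)
  · simp only [AlgHomClass.commutes, FunctionAlgebra.comul_algebraMap]
  · obtain ⟨a, rfl⟩ := label.surjective i
    obtain ⟨b, rfl⟩ := label.surjective j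
    rw [comul, lift_coaction, comul_toPolygon_coaction, comulMatrix, Matrix.of_apply, map_sum,
      ← label.sum_comp]
    simp only [MaxTensor.map_tmul]
  · simp only [map_add, FunctionAlgebra.comul_add, ha, hb]
  · simp only [map_mul, FunctionAlgebra.comul_mul, ha, hb]

theorem counit_eq (h : QuantumSymmetry (incidencyMatrix X)) :
    counit (incidencyMatrix X) h = FunctionAlgebra.counit (toPolygon hX h) := by
  have : counit (incidencyMatrix X) =
      (Pi.evalStarAlgHom ℂ (fun _ : polygonGroup n => ℂ) 1).comp (toPolygon hX) := by
    refine hom_ext fun i j => ?_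
    obtain ⟨a, rfl⟩ := label.surjective i
    obtain ⟨b, rfl⟩ := label.surjective j
    refine (lift_coaction isMagicBiunitary_one _ (label a) (label b)).trans ?_
    rw [StarAlgHom.comp_apply, toPolygon_coaction]
    simp [Matrix.one_apply, eq_comm]
    rfl
  rw [this]
  rfl

theorem toPolygon_antipode (h : QuantumSymmetry (incidencyMatrix X)) :
    toPolygon hX (antipode (incidencyMatrix X) h).unop =
      FunctionAlgebra.antipode (toPolygon hX h) := by
  refine induction_on (P := fun h => toPolygon hX (antipode (incidencyMatrix X) h).unop =
      FunctionAlgebra.antipode (toPolygon hX h)) h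
    (isClosed_eq ((map_continuous _).comp (MulOpposite.continuous_unop.comp (map_continuous _)))
      ?_)
    (fun c => ?_) (fun i j => ?_) (fun a b ha hb => ?_) (fun a b ha hb => ?_)
  · have hc := map_continuous (toPolygon hX)
    unfold FunctionAlgebra.antipode
    fun_prop
  · rw [AlgHomClass.commutes, AlgHomClass.commutes, MulOpposite.algebraMap_apply,
      MulOpposite.unop_op, AlgHomClass.commutes]
    rfl
  · obtain ⟨a, rfl⟩ := label.surjective i
    obtain ⟨b, rfl⟩ := label.surjective j
    rw [antipode, lift_coaction, antipodeMatrix, Matrix.of_apply, MulOpposite.unop_op,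
      toPolygon_coaction, toPolygon_coaction]
    funext σ
    refine if_congr ?_ rfl rfl
    rw [Subgroup.coe_inv, Equiv.Perm.inv_def, Equiv.symm_apply_eq, eq_comm]
  · rw [map_add, MulOpposite.unop_add, map_add, ha, hb, map_add]
    rfl
  · rw [map_mul, MulOpposite.unop_mul, map_mul, ha, hb, map_mul, mul_comm]
    rfl

end QuantumSymmetry

/-! ### Orbits of the dihedral group on tuples -/

/-- The dihedral group acts on the vertices of the `n`-gon. The action is not faithful for
`n ≤ 2`. -/
noncomputable instance DihedralGroup.instMulActionZMod (n : ℕ) :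
    MulAction (DihedralGroup n) (ZMod n) :=
  MulAction.compHom _ (dihedralHom n)

theorem MulAction.card_fixedBy_pi {G M : Type*} [Group G] [MulAction G M] (g : G) (k : ℕ) :
    Nat.card (fixedBy (Fin k → M) g) = Nat.card (fixedBy M g) ^ k := by
  have e : fixedBy (Fin k → M) g ≃ (Fin k → fixedBy M g) :=
    (Equiv.subtypeEquivRight fun f => by simp [mem_fixedBy, funext_iff]).trans
      (Equiv.subtypePiEquivPi (p := fun _ (a : M) => a ∈ fixedBy M g))
  rw [Nat.card_congr e, Nat.card_fun, Nat.card_fin]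

namespace DihedralGroup

open MulAction

variable {n : ℕ}

theorem smul_eq (g : DihedralGroup n) (a : ZMod n) : g • a = dihedralHom n g a := rfl

theorem r_smul (i a : ZMod n) : r i • a = i + a := rfl

theorem sr_smul (i a : ZMod n) : sr i • a = -i - a := rfl

theorem card_fixedBy_r [NeZero n] (i : ZMod n) :
    Nat.card (fixedBy (ZMod n) (r i)) = if i = 0 then n else 0 := by
  split_ifs with h
  · have : fixedBy (ZMod n) (r i) = Set.univ := by
      ext a
      simp [h]
    rw [this, Nat.card_univ, Nat.card_zmod]
  · have : fixedBy (ZMod n) (r i) = ∅ := by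
      ext a
      simp [mem_fixedBy, r_smul, h]
    rw [this, Nat.card_coe_set_eq, Set.ncard_empty]

theorem card_fixedBy_sr [NeZero n] (i : ZMod n) :
    Nat.card (fixedBy (ZMod n) (sr i)) =
      (Finset.univ.filter fun a : ZMod n => a + a = -i).card := by
  rw [← Set.ncard_coe_finset, Nat.card_coe_set_eq]
  congr 1
  ext a
  simp only [mem_fixedBy, sr_smul, Finset.coe_filter_univ, Set.mem_ofPred_eq]
  rw [sub_eq_iff_eq_add, eq_comm]

theorem card_add_self_eq_zero [NeZero n] :
    (Finset.univ.filter fun a : ZMod n => a + a = 0).card = if Odd n then 1 else 2 := by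
  split_ifs with h
  · rw [Finset.card_eq_one]
    refine ⟨0, ?_⟩
    ext a
    simp [ZMod.add_self_eq_zero_iff_eq_zero h]
  · obtain ⟨m, hm⟩ := Nat.not_odd_iff_even.1 h
    have hn := NeZero.pos n
    have hval : ((m : ℕ) : ZMod n).val = m := ZMod.val_cast_of_lt (by omega)
    rw [Finset.card_eq_two]
    refine ⟨0, (m : ZMod n), fun h0 => ?_, ?_⟩
    · rw [← h0, ZMod.val_zero] at hval
      omega
    · ext a
      rw [Finset.mem_filter_univ, ← neg_eq_iff_add_eq_zero, ZMod.neg_eq_self_iff,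
        Finset.mem_insert, Finset.mem_singleton]
      refine or_congr_right ⟨fun ha => ?_, fun ha => ?_⟩
      · rw [show m = a.val by omega, ZMod.natCast_zmod_val]
      · rw [ha, hval]
        omega

/-- The fibers of `a ↦ a + a` are empty, or have as many elements as its kernel. -/
theorem card_fixedBy_sr_eq [NeZero n] (i : ZMod n) :
    Nat.card (fixedBy (ZMod n) (sr i)) = 0 ∨
      Nat.card (fixedBy (ZMod n) (sr i)) = if Odd n then 1 else 2 := by
  rw [card_fixedBy_sr, ← card_add_self_eq_zero]
  let f : ZMod n →+ ZMod n := AddMonoidHom.id _ + AddMonoidHom.id _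
  by_cases h : -i ∈ Set.range f
  · exact Or.inr (AddMonoidHom.card_fiber_eq_of_mem_range f h ⟨0, map_zero f⟩)
  · refine Or.inl (Finset.card_eq_zero.2 (Finset.filter_eq_empty_iff.2 fun a _ ha => h ⟨a, ha⟩))

theorem sum_card_fixedBy_sr [NeZero n] :
    ∑ i : ZMod n, Nat.card (fixedBy (ZMod n) (sr i)) = n := by
  simp only [card_fixedBy_sr]
  rw [← Equiv.sum_comp (Equiv.neg _)]
  simp only [Equiv.neg_apply, neg_neg]
  rw [← Finset.card_eq_sum_card_fiberwise (fun _ _ => Finset.mem_coe.2 (Finset.mem_univ _)),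
    Finset.card_univ, ZMod.card]

theorem sum_univ {M : Type*} [AddCommMonoid M] [NeZero n] (f : DihedralGroup n → M) :
    ∑ g, f g = ∑ i, f (r i) + ∑ i, f (sr i) := by
  rw [← equivSum.symm.sum_comp, Fintype.sum_sum_type]
  rfl

/-- Burnside's lemma. A rotation fixes tuples only if it is trivial; a symmetry which fixes at
least one vertex fixes one or two of them, according to the parity of `n`, and the sets of fixed
vertices of the symmetries have `n` elements in total. Using the abstract dihedral group, of order
`2n` also for `n ≤ 2`, makes the count uniform in `n`. -/
theorem two_mul_card_orbits [NeZero n] (k : ℕ) :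
    2 * Nat.card (orbitRel.Quotient (DihedralGroup n) (Fin (k + 1) → ZMod n)) =
      n ^ k + (if Odd n then 1 else 2) ^ k := by
  classical
  have hb := sum_card_fixedBy_eq_card_orbits_mul_card_group (DihedralGroup n)
    (Fin (k + 1) → ZMod n)
  simp only [← Nat.card_eq_fintype_card, card_fixedBy_pi] at hb
  have hsr : ∀ i : ZMod n, Nat.card (fixedBy (ZMod n) (sr i)) ^ (k + 1) =
      (if Odd n then 1 else 2) ^ k * Nat.card (fixedBy (ZMod n) (sr i)) := by
    intro i
    rcases card_fixedBy_sr_eq i with h | h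
    · rw [h, zero_pow (Nat.succ_ne_zero k), mul_zero]
    · rw [h, pow_succ]
  have hr : ∑ i : ZMod n, Nat.card (fixedBy (ZMod n) (r i)) ^ (k + 1) = n ^ (k + 1) := by
    simp only [card_fixedBy_r, ite_pow, zero_pow (Nat.succ_ne_zero k), Finset.sum_ite_eq',
      Finset.mem_univ, if_true]
  rw [sum_univ, hr, Finset.sum_congr rfl fun i _ => hsr i, ← Finset.mul_sum, sum_card_fixedBy_sr,
    nat_card] at hb
  refine Nat.eq_of_mul_eq_mul_right (NeZero.pos n) ?_
  rw [mul_comm 2, mul_assoc, add_mul, ← pow_succ]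
  exact hb.symm

end DihedralGroup

/-! ### The Poincaré series -/

namespace QuantumSymmetry

variable {V : Type*} [Fintype V] {X : SimpleGraph V} {n : ℕ} [NeZero n] {label : ZMod n ≃ V}
  (hX : IsCyclicLabelling X label)

/-- When `H(X)` is the algebra of functions on the dihedral group, the fixed points of the tensor
powers of the coaction are the functions on tuples which are invariant under this group. -/
theorem mem_fixedPoints_iff (hinj : Function.Injective (toPolygon hX)) {k : ℕ}
    (f : (Fin k → V) → ℂ) :
    f ∈ fixedPoints (coaction (incidencyMatrix X)) k ↔
      ∀ (g : DihedralGroup n) (a : Fin k → ZMod n), f (label ∘ (g • a)) = f (label ∘ a) := by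
  have hentry : ∀ (σ : polygonGroup n) (j i : Fin k → ZMod n),
      toPolygon hX (List.ofFn fun l =>
        coaction (incidencyMatrix X) (label (j l)) (label (i l))).prod σ =
      if (fun l => σ.1⁻¹ (j l)) = i then 1 else 0 := by
    intro σ j i
    have : ∀ l, (σ.1 (i l) = j l) ↔ σ.1⁻¹ (j l) = i l := fun l => by
      rw [Equiv.Perm.inv_eq_iff_eq, eq_comm]
    rw [map_list_prod, List.map_ofFn, List.prod_ofFn, Finset.prod_apply]
    simp only [Function.comp_apply, toPolygon_coaction, this]
    rw [Fintype.prod_ite_zero, Finset.prod_const_one]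
    simp only [funext_iff]
    congr
  have hsum : ∀ (σ : polygonGroup n) (j : Fin k → ZMod n),
      toPolygon hX (∑ i : Fin k → V, f i • (List.ofFn fun l =>
        coaction (incidencyMatrix X) ((label ∘ j) l) (i l)).prod) σ =
      f (label ∘ fun l => σ.1⁻¹ (j l)) := by
    intro σ j
    rw [map_sum, Finset.sum_apply, ← (Equiv.arrowCongr (Equiv.refl _) label).sum_comp]
    simp only [map_smul, Pi.smul_apply, Equiv.arrowCongr_apply, Equiv.refl_symm,
      Equiv.coe_refl, Function.comp_apply, Function.comp_id, hentry, smul_eq_mul, mul_ite,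
      mul_one, mul_zero, Finset.sum_ite_eq, Finset.mem_univ, if_true]
    rfl
  have hmem : f ∈ fixedPoints (coaction (incidencyMatrix X)) k ↔
      ∀ (σ : polygonGroup n) (j : Fin k → ZMod n),
        f (label ∘ fun l => σ.1⁻¹ (j l)) = f (label ∘ j) := by
    constructor
    · intro h σ j
      have := congrFun (congrArg (toPolygon hX) (h (label ∘ j))) σ
      rw [hsum, map_smul, map_one] at this
      simpa using this
    · intro h j
      obtain ⟨j, rfl⟩ := (Equiv.arrowCongr (Equiv.refl _) label).surjective j
      refine hinj (funext fun σ => ?_)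
      refine (hsum σ j).trans ((h σ j).trans ?_)
      rw [map_smul, map_one]
      simp only [Pi.smul_apply, Pi.one_apply, smul_eq_mul, mul_one]
      rfl
  rw [hmem]
  constructor
  · intro h g a
    have := h ⟨dihedralHom n g⁻¹, g⁻¹, rfl⟩ a
    simp only [map_inv, inv_inv] at this
    exact this
  · rintro h ⟨_, g, rfl⟩ j
    have := h g⁻¹ j
    rw [← this]
    congr 2
    funext l
    rw [Pi.smul_apply, DihedralGroup.smul_eq, map_inv]

theorem poincareCoeff_eq_card_orbits (hinj : Function.Injective (toPolygon hX)) (k : ℕ) :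
    poincareCoeff (coaction (incidencyMatrix X)) k =
      Nat.card (MulAction.orbitRel.Quotient (DihedralGroup n) (Fin k → ZMod n)) := by
  classical
  let e : fixedPoints (coaction (incidencyMatrix X)) k ≃ₗ[ℂ]
      (MulAction.orbitRel.Quotient (DihedralGroup n) (Fin k → ZMod n) → ℂ) :=
    { toFun := fun f => Quotient.lift (fun a => f.1 (label ∘ a)) (by
        rintro _ b ⟨g, rfl⟩
        exact (mem_fixedPoints_iff hX hinj f.1).1 f.2 g b)
      map_add' := fun f f' => by
        ext q
        induction q using Quotient.inductionOn with | _ a => rfl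
      map_smul' := fun c f => by
        ext q
        induction q using Quotient.inductionOn with | _ a => rfl
      invFun := fun F => ⟨fun i => F (Quotient.mk _ (label.symm ∘ i)),
        (mem_fixedPoints_iff hX hinj _).2 fun g a => congrArg F (Quotient.sound ⟨g, by
          simp [← Function.comp_assoc]⟩)⟩
      left_inv := fun f => by
        ext i
        change f.1 (label ∘ label.symm ∘ i) = f.1 i
        simp [← Function.comp_assoc]
      right_inv := fun F => by
        ext q
        induction q using Quotient.inductionOn with
        | _ a =>
          change F (Quotient.mk _ (label.symm ∘ label ∘ a)) = _
          simp [← Function.comp_assoc] }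
  rw [poincareCoeff, e.finrank_eq, Module.finrank_fintype_fun_eq_card, Nat.card_eq_fintype_card]

theorem poincareCoeff_zero (hinj : Function.Injective (toPolygon hX)) :
    poincareCoeff (coaction (incidencyMatrix X)) 0 = 1 := by
  rw [poincareCoeff_eq_card_orbits hX hinj, Nat.card_eq_one_iff_unique]
  exact ⟨inferInstance, ⟨Quotient.mk _ default⟩⟩

theorem poincareCoeff_succ (hinj : Function.Injective (toPolygon hX)) (k : ℕ) :
    2 * poincareCoeff (coaction (incidencyMatrix X)) (k + 1) =
      n ^ k + (if Odd n then 1 else 2) ^ k := by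
  rw [poincareCoeff_eq_card_orbits hX hinj, DihedralGroup.two_mul_card_orbits]

end QuantumSymmetry

section Series

variable {n : ℕ} [NeZero n] {c : ℕ → ℕ}

theorem ite_odd_le_self : (if Odd n then 1 else 2) ≤ n := by
  have := NeZero.pos n
  split_ifs with h
  · omega
  · have : n ≠ 1 := by rintro rfl; exact h odd_one
    omega

theorem hasSum_of_two_mul_eq (h0 : c 0 = 1)
    (hc : ∀ k, 2 * c (k + 1) = n ^ k + (if Odd n then 1 else 2) ^ k) {z : ℂ} (hz : ‖z‖ < (n : ℝ)⁻¹) :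
    HasSum (fun k => (c k : ℂ) * z ^ k)
      (1 + z / 2 * (1 / (1 - (if Odd n then (1 : ℂ) else 2) * z) + 1 / (1 - n * z))) := by
  have hn : (0 : ℝ) < n := Nat.cast_pos.2 (NeZero.pos n)
  have hgeom : ∀ m : ℕ, m ≤ n → HasSum (fun k => ((m : ℂ) * z) ^ k) (1 - m * z)⁻¹ := by
    intro m hm
    apply hasSum_geometric_of_norm_lt_one
    rw [norm_mul, Complex.norm_natCast]
    have hm' : (m : ℝ) ≤ n := Nat.cast_le.2 hm
    calc (m : ℝ) * ‖z‖ ≤ n * ‖z‖ := mul_le_mul_of_nonneg_right hm' (norm_nonneg z)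
      _ < n * (n : ℝ)⁻¹ := mul_lt_mul_of_pos_left hz hn
      _ = 1 := mul_inv_cancel₀ hn.ne'
  have h := ((hgeom _ (ite_odd_le_self (n := n))).add (hgeom n le_rfl)).mul_left (z / 2)
  rw [← hasSum_nat_add_iff' 1]
  have hterm : ∀ k, (c (k + 1) : ℂ) * z ^ (k + 1) =
      z / 2 * ((((if Odd n then 1 else 2 : ℕ) : ℂ) * z) ^ k + (n * z) ^ k) := by
    intro k
    have : (2 : ℂ) * c (k + 1) = n ^ k + ((if Odd n then 1 else 2 : ℕ) : ℂ) ^ k := by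
      exact_mod_cast hc k
    rw [mul_pow, mul_pow]
    linear_combination z ^ (k + 1) / 2 * this
  simp only [hterm, Finset.sum_range_one, h0, pow_zero, Nat.cast_one, mul_one, add_sub_cancel_left,
    one_div]
  simpa only [Nat.cast_ite, Nat.cast_one, Nat.cast_ofNat] using h

theorem radius_ofScalars_of_two_mul_eq (h0 : c 0 = 1)
    (hc : ∀ k, 2 * c (k + 1) = n ^ k + (if Odd n then 1 else 2) ^ k) :
    (FormalMultilinearSeries.ofScalars ℂ fun k => (c k : ℂ)).radius = (n : ENNReal)⁻¹ := by
  have hn : (0 : ℝ) < n := Nat.cast_pos.2 (NeZero.pos n)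
  have hnn : (n : NNReal) ≠ 0 := NeZero.ne _
  rw [← ENNReal.coe_natCast, ← ENNReal.coe_inv hnn]
  apply le_antisymm
  -- inside the disc of convergence the terms would tend to zero, but at `1 / n` they are at
  -- least `1 / (2 * n)`
  · by_contra! hlt
    have := (FormalMultilinearSeries.ofScalars ℂ fun k => (c k : ℂ)).summable_norm_mul_pow hlt
    have hlim := (this.tendsto_atTop_zero.comp (Filter.tendsto_add_atTop_nat 1))
    have hge : ∀ k, (2 * n : ℝ)⁻¹ ≤
        ‖FormalMultilinearSeries.ofScalars ℂ (fun k => (c k : ℂ)) (k + 1)‖ *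
          (((n : NNReal)⁻¹ : NNReal) : ℝ) ^ (k + 1) := by
      intro k
      rw [FormalMultilinearSeries.ofScalars_norm, Complex.norm_natCast, NNReal.coe_inv,
        NNReal.coe_natCast]
      have h2 : (n : ℝ) ^ k ≤ 2 * c (k + 1) := by
        have := Nat.le.intro (hc k).symm
        exact_mod_cast this
      calc (2 * n : ℝ)⁻¹ = (n ^ k / 2) * (n : ℝ)⁻¹ ^ (k + 1) := by
            rw [inv_pow, pow_succ]
            field_simp
        _ ≤ c (k + 1) * (n : ℝ)⁻¹ ^ (k + 1) := by
            refine mul_le_mul_of_nonneg_right ?_ (by positivity)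
            linarith
    have := ge_of_tendsto' hlim hge
    have : (0 : ℝ) < (2 * n : ℝ)⁻¹ := by positivity
    linarith
  · refine FormalMultilinearSeries.le_radius_of_bound _ 1 fun k => ?_
    rw [FormalMultilinearSeries.ofScalars_norm, Complex.norm_natCast, NNReal.coe_inv,
      NNReal.coe_natCast, inv_pow, ← div_eq_mul_inv, div_le_one (by positivity)]
    rcases k with _ | k
    · simp [h0]
    · have h1 : (if Odd n then 1 else 2) ^ k ≤ n ^ k := Nat.pow_le_pow_left ite_odd_le_self k
      have h2 : n ^ k ≤ n ^ (k + 1) := Nat.pow_le_pow_right (NeZero.pos n) (Nat.le_succ k)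
      have := hc k
      have : c (k + 1) ≤ n ^ (k + 1) := by omega
      exact_mod_cast this

end Series

theorem theorem4p2 {V : Type*} [Fintype V] (X : SimpleGraph V) (n : ℕ) [NeZero n] (hn : n ≠ 4)
    (label : ZMod n ≃ V) (hX : IsCyclicLabelling X label)
    (w : ℂ) (hw : IsPrimitiveRoot w n)
    (hQ : Set.InjOn (fun k : ℕ => (associatedPolynomial X label).eval (w ^ k))
      (Set.Iic (n / 2))) :
    (∃ Φ : QuantumSymmetry (incidencyMatrix X) ≃⋆ₐ[ℂ] (polygonGroup n → ℂ),
      (∀ a b : ZMod n,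
        Φ (QuantumSymmetry.coaction (incidencyMatrix X) (label a) (label b)) =
          fun σ : polygonGroup n => if σ.1 b = a then (1 : ℂ) else 0) ∧
      (∀ h, MaxTensor.map (Φ : QuantumSymmetry (incidencyMatrix X) →⋆ₐ[ℂ] (polygonGroup n → ℂ))
            (Φ : QuantumSymmetry (incidencyMatrix X) →⋆ₐ[ℂ] (polygonGroup n → ℂ))
            (QuantumSymmetry.comul (incidencyMatrix X) h) = FunctionAlgebra.comul (Φ h)) ∧
      (∀ h, QuantumSymmetry.counit (incidencyMatrix X) h = FunctionAlgebra.counit (Φ h)) ∧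
      (∀ h, Φ (QuantumSymmetry.antipode (incidencyMatrix X) h).unop =
        FunctionAlgebra.antipode (Φ h))) ∧
    (∀ z : ℂ, ‖z‖ < (n : ℝ)⁻¹ →
      HasSum
        (fun k => (poincareCoeff (QuantumSymmetry.coaction (incidencyMatrix X)) k : ℂ) * z ^ k)
        (1 + z / 2 * (1 / (1 - (if Odd n then (1 : ℂ) else 2) * z) + 1 / (1 - n * z)))) ∧
    (poincareSeries (QuantumSymmetry.coaction (incidencyMatrix X))).radius = (n : ENNReal)⁻¹ := by
  have hinj := QuantumSymmetry.toPolygon_injective hX hn hw hQ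
  have h0 := QuantumSymmetry.poincareCoeff_zero hX hinj
  have hc := QuantumSymmetry.poincareCoeff_succ hX hinj
  refine ⟨⟨StarAlgEquiv.ofBijective (QuantumSymmetry.toPolygon hX)
      ⟨hinj, QuantumSymmetry.toPolygon_surjective hX⟩,
    QuantumSymmetry.toPolygon_coaction hX, QuantumSymmetry.map_comul_eq hX,
    QuantumSymmetry.counit_eq hX, QuantumSymmetry.toPolygon_antipode hX⟩,
    fun z hz => hasSum_of_two_mul_eq h0 hc hz, radius_ofScalars_of_two_mul_eq h0 hc⟩
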